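/- Consider the M/M/1 retrial queue with arrival rate $\lambda>0$, service rate $\mu>0$, retrial rate $\theta>0$ per customer in the orbit, and $\rho=\lambda/\mu<1$. Let $C(t)\in\{W,I\}$ be the state of the server (busy, idle) and $N(t)\in\{0,1,2,\dots\}$ the number of customers in the orbit: $(C(t),N(t))_{t\ge 0}$ is the continuous-time Markov chain, with an arbitrary initial law, whose transitions are $(W,k)\to(W,k+1)$ at rate $\lambda$, $(W,k)\to(I,k)$ at rate $\mu$, $(I,k)\to(W,k)$ at rate $\lambda$, and $(I,k)\to(W,k-1)$ at rate $k\theta$ for $k\ge1$. Then the limits $x_{c,k}=\lim_{t\to\infty}P\{C(t)=c,N(t)=k\}$ exist for $c\in\{W,I\}$, $k\ge 0$, and form a probability vector. Put $\pi_{c,k}=\sum_{j\ge k}x_{c,j}$ and $\Pi_k=(\pi_{W,k},\pi_{I,k})$. Then $\Pi_0=(\rho,1-\rho)$, and $\Pi=(\Pi_1,\Pi_2,\dots)$ satisfies $$\Pi Q=(-\lambda\rho,0,0,\dots),$$ with all the series involved convergent, where $Q$ is the infinite matrix of $2\times2$ blocks $Q_{k,k+1}=C$, $Q_{k,k}=A_k$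 $(k\ge1)$, $Q_{k,k-1}=B_k$ $(k\ge2)$, $Q_{k,j}=D$ $(1\le j\le k-2)$, $Q_{k,j}=0$ $(j\ge k+2)$, with $$A_k=\begin{pmatrix}-(\lambda+\mu)&\mu\\ \lambda&-(\lambda+k\theta)\end{pmatrix},\quad B_k=\begin{pmatrix}0&0\\ k\theta&-\theta\end{pmatrix},\quad C=\begin{pmatrix}\lambda&0\\0&0\end{pmatrix},\quad D=\begin{pmatrix}0&0\\ \theta&-\theta\end{pmatrix}.$$ Moreover, the system $$C+R_kA_{k+1}+R_kR_{k+1}B_{k+2}+R_kR_{k+1}\Bigl(\sum_{l=2}^{\infty}R_{k+2}R_{k+3}\cdots R_{k+l}\Bigr)D=0,\qquad k\ge1,$$ has an (entrywise) minimal solution $\{R_k:k\ge1\}$ among the sequences of nonnegative $2\times 2$ matrices for which these series converge. For this solution (the $R$-measure), the series $\sum_{l\ge1}R_k\cdots R_{k+l-1}$ converges for every $k\ge1$, and the matrices $$\Psi_k=A_k+R_kB_{k+1}+R_k\Bigl(\sum_{l=1}^{\infty}R_{k+1}\cdots R_{k+l}\Bigr)D,\qquad k\ge1,$$ are invertible,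 with $R_k=C(-\Psi_{k+1})^{-1}$. With $$G_{i,i-1}=(-\Psi_i)^{-1}\Bigl[B_i+\Bigl(\sum_{l=1}^\infty R_i\cdots R_{i+l-1}\Bigr)D\Bigr],\qquad G_i=(-\Psi_i)^{-1}\Bigl(I+\sum_{l=1}^\infty R_i\cdots R_{i+l-1}\Bigr)D,$$ the UL-type $RG$-factorization $$Q=(I-R_U)\,U_D\,(I-G_L)$$ holds, where $U_D=\mathrm{diag}(\Psi_1,\Psi_2,\dots)$, $R_U$ has the blocks $R_k$ at the positions $(k,k+1)$, $k\ge1$, and zero blocks elsewhere, and $G_L$ has the blocks $G_{i,i-1}$ at the positions $(i,i-1)$, $i\ge2$, the blocks $G_i$ at the positions $(i,j)$, $1\le j\le i-2$, and zero blocks elsewhere. Finally, $$\Pi_1=(\lambda\rho,0)\,(-\Psi_1^{-1}),\qquad \Pi_k=(\lambda\rho,0)\,(-\Psi_1^{-1})\,R_1R_2\cdots R_{k-1}\quad(k\ge2).$$ -/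

import Mathlib

open MeasureTheory ProbabilityTheory Filter Topology
open scoped NNReal Matrix

noncomputable section

namespace RetrialQueue

/-- Server state `W` (busy). -/
abbrev busy : Fin 2 := 0

/-- Server state `I` (idle). -/
abbrev idle : Fin 2 := 1

/-- A state `(C, N)`: the server state and the number of customers in the orbit. -/
abbrev State : Type := Fin 2 × ℕ

/-- The `2 × 2` blocks; rows and columns are ordered as `(W, I)`. -/
abbrev Block : Type := Matrix (Fin 2) (Fin 2) ℝ

/-- The infinitesimal generator of `(C(t), N(t))`: arrivals at rate `lam` start a service
when the server is idle and join the orbit when it is busy, a service ends at rate `mu`, and each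
of the `k` customers in the orbit retries at rate `theta`, successfully if the server is idle.
(For `k = 0` the retrial term has coefficient `0`.) -/
def generator (lam mu theta : ℝ) (f : State → ℝ) (s : State) : ℝ :=
  if s.1 = busy then
    lam * (f (busy, s.2 + 1) - f s) + mu * (f (idle, s.2) - f s)
  else
    lam * (f (busy, s.2) - f s) + (s.2 : ℝ) * theta * (f (busy, s.2 - 1) - f s)

/-- `X` is the Markov jump process `(C(t), N(t))` of the M/M/1 retrial queue, on a filtered
probability space and with an arbitrary initial law: an adapted right-continuous process that
solves the martingale problem of the generator (with finitely supported test functions). -/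
structure IsRetrialQueue {Ω : Type*} {mΩ : MeasurableSpace Ω} (lam mu theta : ℝ)
    (P : Measure Ω) (ℱ : Filtration ℝ≥0 mΩ) (X : ℝ≥0 → Ω → State) : Prop where
  adapted : ∀ t, Measurable[ℱ t] (X t)
  rightContinuous : ∀ ω t, ContinuousWithinAt (fun s => X s ω) (Set.Ici t) t
  martingale : ∀ f : State → ℝ, (Function.support f).Finite →
    Martingale (fun (t : ℝ≥0) (ω : Ω) =>
      f (X t ω) - ∫ s in (0 : ℝ)..(t : ℝ), generator lam mu theta f (X s.toNNReal ω)) ℱ P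

/-- The row vector `Π_k = (π_{W,k}, π_{I,k})`, `π_{c,k} = ∑_{j ≥ k} x_{c,j}`. -/
def tailPair (x : State → ℝ) (k : ℕ) : Fin 2 → ℝ := fun c => ∑' j : ℕ, x (c, k + j)

/-- The diagonal block `A_k`. -/
def blockA (lam mu theta : ℝ) (k : ℕ) : Block :=
  !![-(lam + mu), mu; lam, -(lam + k * theta)]

/-- The subdiagonal block `B_k` (`k ≥ 2`). -/
def blockB (theta : ℝ) (k : ℕ) : Block := !![0, 0; k * theta, -theta]

/-- The superdiagonal block `C`. -/
def blockC (lam : ℝ) : Block := !![lam, 0; 0, 0]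

/-- The block `D` below the subdiagonal. -/
def blockD (theta : ℝ) : Block := !![0, 0; theta, -theta]

/-- The infinite block matrix `Q`. The indices `i`, `j` stand for the levels `i + 1`, `j + 1`,
here and in all infinite block matrices below. -/
def Q (lam mu theta : ℝ) : Matrix ℕ ℕ Block := fun i j =>
  if j = i + 1 then blockC lam
  else if j = i then blockA lam mu theta (i + 1)
  else if j + 1 = i then blockB theta (i + 1)
  else if j + 1 < i then blockD theta
  else 0

/-- `R_k R_{k+1} ⋯ R_{k+l-1}` (`l` factors). -/
def prodR (R : ℕ → Block) (k : ℕ) : ℕ → Block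
  | 0 => 1
  | l + 1 => prodR R k l * R (k + l)

/-- `∑_{l ≥ 1} R_k R_{k+1} ⋯ R_{k+l-1}`. -/
def sumR (R : ℕ → Block) (k : ℕ) : Block := ∑' l : ℕ, prodR R k (l + 1)

/-- `(R_k)_{k ≥ 1}` is nonnegative, the series below converge, and for all `k ≥ 1`,
`C + R_k A_{k+1} + R_k R_{k+1} B_{k+2} + R_k R_{k+1} (∑_{l ≥ 2} R_{k+2} ⋯ R_{k+l}) D = 0`.
The value `R 0` plays no role. -/
def IsNonnegSolution (lam mu theta : ℝ) (R : ℕ → Block) : Prop :=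
  ∀ k : ℕ, 1 ≤ k →
    (∀ a b, 0 ≤ R k a b) ∧
    Summable (fun l : ℕ => prodR R (k + 2) (l + 1)) ∧
    blockC lam + R k * blockA lam mu theta (k + 1) + R k * R (k + 1) * blockB theta (k + 2)
      + R k * R (k + 1) * sumR R (k + 2) * blockD theta = 0

/-- The `R`-measure: the entrywise minimal nonnegative solution. -/
def IsRMeasure (lam mu theta : ℝ) (R : ℕ → Block) : Prop :=
  IsNonnegSolution lam mu theta R ∧
    ∀ S : ℕ → Block, IsNonnegSolution lam mu theta S →
      ∀ k : ℕ, 1 ≤ k → ∀ a b, R k a b ≤ S k a b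

/-- `Ψ_k = A_k + R_k B_{k+1} + R_k (∑_{l ≥ 1} R_{k+1} ⋯ R_{k+l}) D`. -/
def Psi (lam mu theta : ℝ) (R : ℕ → Block) (k : ℕ) : Block :=
  blockA lam mu theta k + R k * blockB theta (k + 1) + R k * sumR R (k + 1) * blockD theta

/-- `G_{i,i-1} = (-Ψ_i)⁻¹ (B_i + (∑_{l ≥ 1} R_i ⋯ R_{i+l-1}) D)`. -/
def Gsub (lam mu theta : ℝ) (R : ℕ → Block) (i : ℕ) : Block :=
  (-Psi lam mu theta R i)⁻¹ * (blockB theta i + sumR R i * blockD theta)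

/-- `G_i = G_{i,j} = (-Ψ_i)⁻¹ (I + ∑_{l ≥ 1} R_i ⋯ R_{i+l-1}) D` for `1 ≤ j ≤ i - 2`. -/
def Glow (lam mu theta : ℝ) (R : ℕ → Block) (i : ℕ) : Block :=
  (-Psi lam mu theta R i)⁻¹ * (1 + sumR R i) * blockD theta

/-- The strictly upper triangular factor `R_U`. -/
def factorRU (R : ℕ → Block) : Matrix ℕ ℕ Block := fun i j => if j = i + 1 then R (i + 1) else 0

/-- The block diagonal factor `U_D = diag(Ψ_1, Ψ_2, …)`. -/
def factorUD (lam mu theta : ℝ) (R : ℕ → Block) : Matrix ℕ ℕ Block :=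
  Matrix.diagonal fun i => Psi lam mu theta R (i + 1)

/-- The strictly lower triangular factor `G_L`. -/
def factorGL (lam mu theta : ℝ) (R : ℕ → Block) : Matrix ℕ ℕ Block := fun i j =>
  if j + 1 = i then Gsub lam mu theta R (i + 1)
  else if j + 1 < i then Glow lam mu theta R (i + 1)
  else 0

/-- The product of infinite block matrices. It is only used for products in which every row of the
left factor has finitely many nonzero blocks, so that all the sums are finite. -/
def blockMul (M N : Matrix ℕ ℕ Block) : Matrix ℕ ℕ Block := fun i j => ∑' l : ℕ, M i l * N l j

end RetrialQueue

end

namespace RetrialQueue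

/-! The stationary law is explicit. Equality of flows across the cut between neighbouring orbit
levels, together with balance at the idle states, gives a one-step recursion whose ratio tends to
`λ/μ < 1`, hence a positive solution with finite first moment (`exists_isStationary`). Summing the
two relations over all levels from `k` on gives `cut_tail` and `balance_tail`, which yield `Π_0`,
the linear system for `Π` and the identities behind the `R`-measure.

The `R`-measure is identified through uniqueness instead of monotone iteration. For a solution `S`
and a row vector `u`, the sequence `u S_k ⋯ S_{k+l-1}` tends to zero, and its successive differences
obey the cut and balance recursions. They are therefore proportional to `x`, and the sequence itself
to the tails. This forces `S_k = tailRatio x k` (`eq_tailRatio_of_isNonnegSolution`), so minimality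
is automatic. Products of these matrices telescope, `Ψ_k` has a closed form with positive
determinant, and the factorization becomes block algebra based on `sumR R k = R k * (1 + sumR R (k +
1))`.

Convergence in law follows from an energy method. The martingale problem, tested on indicators of
points, gives the forward equations for the probability `p` of starting in `s₀` and being in `s`.
The density `p / x` evolves under the time-reversed chain, so convex functionals of it decrease up
to a flux through the truncation level (`energy_le`). A convex function vanishing up to `c`
propagates `p ≤ c x` (`le_mul`). The square then bounds the total dissipation
(`integral_dissipation_le`), so the densities at neighbouring states merge, and conservation of mass
identifies their limit (`tendsto_stationary`). Summation over `s₀` covers every initial law. -/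

/-! ### The stationary distribution. -/

/-- `x` is a stationary distribution of the retrial queue: the balance equations of the idle states,
and the cut equations between consecutive orbit levels. -/
structure IsStationary (lam mu theta : ℝ) (x : State → ℝ) : Prop where
  pos : ∀ s, 0 < x s
  hasSum : HasSum x 1
  balance : ∀ k : ℕ, mu * x (busy, k) = (lam + k * theta) * x (idle, k)
  cut : ∀ k : ℕ, ((k : ℝ) + 1) * theta * x (idle, k + 1) = lam * x (busy, k)
  summable_mul : ∀ c, Summable fun k : ℕ => (k : ℝ) * x (c, k)

/-- An unnormalised stationary measure on the idle states. -/
noncomputable def idleWeight (lam mu theta : ℝ) : ℕ → ℝ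
  | 0 => 1
  | n + 1 => lam * (lam + n * theta) / (mu * ((n + 1) * theta)) * idleWeight lam mu theta n

/-- An unnormalised stationary measure. -/
noncomputable def weight (lam mu theta : ℝ) (s : State) : ℝ :=
  if s.1 = busy then (lam + s.2 * theta) / mu * idleWeight lam mu theta s.2
  else idleWeight lam mu theta s.2

lemma idleWeight_pos {lam mu theta : ℝ} (hlam : 0 < lam) (hmu : 0 < mu) (htheta : 0 < theta)
    (n : ℕ) : 0 < idleWeight lam mu theta n := by
  induction n with
  | zero => simp [idleWeight]
  | succ n ih => rw [idleWeight]; positivity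

lemma summable_prod_fin_two {f : State → ℝ} (hf : ∀ s, 0 ≤ f s)
    (h : ∀ c, Summable fun k : ℕ => f (c, k)) : Summable f :=
  (summable_prod_of_nonneg hf).2 ⟨h, .of_finite⟩

lemma tendsto_add_mul_div_add_mul (a b theta : ℝ) (htheta : 0 < theta) :
    Tendsto (fun n : ℕ => (a + n * theta) / (b + n * theta)) atTop (𝓝 1) := by
  have h : ∀ c : ℝ, Tendsto (fun n : ℕ => c / (n : ℝ) + theta) atTop (𝓝 (0 + theta)) := fun c =>
    (tendsto_const_div_atTop_nhds_zero_nat c).add tendsto_const_nhds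
  have h2 := (h a).div (h b) (by simpa using htheta.ne')
  rw [zero_add, div_self htheta.ne'] at h2
  refine h2.congr' ?_
  filter_upwards [eventually_gt_atTop 0] with n hn
  have hn' : (0 : ℝ) < n := by exact_mod_cast hn
  simp only [Pi.div_apply]
  rw [show a / (n : ℝ) + theta = (a + n * theta) / n by field_simp,
    show b / (n : ℝ) + theta = (b + n * theta) / n by field_simp, div_div_div_cancel_right₀ hn'.ne']

/-- The ratio of successive terms tends to `λ/μ`. The quadratic factor is large enough to control
the first moments of both the idle and the busy weights. -/
lemma summable_mul_mul_idleWeight {lam mu theta : ℝ} (hlam : 0 < lam) (hmu : 0 < mu)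
    (htheta : 0 < theta) (hstable : lam / mu < 1) :
    Summable fun n : ℕ => ((theta + n * theta) * (lam + n * theta)) * idleWeight lam mu theta n := by
  refine summable_of_ratio_test_tendsto_lt_one hstable (.of_forall fun n => ?_) ?_
  · have := idleWeight_pos hlam hmu htheta n
    positivity
  · have h := ((tendsto_add_mul_div_add_mul (2 * theta) theta theta htheta).mul
      (tendsto_add_mul_div_add_mul (lam + theta) theta theta htheta)).const_mul (lam / mu)
    rw [mul_one, mul_one] at h
    refine h.congr fun n => ?_
    have := idleWeight_pos hlam hmu htheta n
    have := idleWeight_pos hlam hmu htheta (n + 1)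
    rw [Real.norm_of_nonneg (by positivity), Real.norm_of_nonneg (by positivity), idleWeight]
    push_cast
    field_simp
    ring

/-- Eliminating the busy states by balance turns the cut equations into the recursion defining
`idleWeight`; normalising `weight` then gives the law. -/
lemma exists_isStationary {lam mu theta : ℝ} (hlam : 0 < lam) (hmu : 0 < mu)
    (htheta : 0 < theta) (hstable : lam / mu < 1) : ∃ x, IsStationary lam mu theta x := by
  have hw := idleWeight_pos hlam hmu htheta
  have hpos : ∀ s, 0 < weight lam mu theta s := fun s => by
    have := hw s.2
    unfold weight; split_ifs <;> positivity
  have hsum := summable_mul_mul_idleWeight hlam hmu htheta hstable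
  have hs : ∀ c, Summable fun k : ℕ => ((k : ℝ) + 1) * weight lam mu theta (c, k) := by
    intro c
    by_cases hc : c = busy
    · refine (hsum.mul_left (1 / (mu * theta))).congr fun k => ?_
      simp only [weight, hc, if_true]
      field_simp
      ring
    · refine Summable.of_nonneg_of_le (fun k => ?_) (fun k => ?_) (hsum.mul_left (1 / (lam * theta)))
      · have := hpos (c, k)
        positivity
      · simp only [weight, hc, if_false]
        have := hw k
        rw [show 1 / (lam * theta) * ((theta + k * theta) * (lam + k * theta) *
          idleWeight lam mu theta k) = (((k : ℝ) + 1) * idleWeight lam mu theta k) *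
            ((lam + k * theta) / lam) by field_simp; ring]
        refine le_mul_of_one_le_right (by positivity) ?_
        rw [one_le_div hlam]
        have : (0 : ℝ) ≤ k * theta := by positivity
        linarith
  have hW : Summable (weight lam mu theta) := by
    refine summable_prod_fin_two (fun s => (hpos s).le) fun c => ?_
    refine Summable.of_nonneg_of_le (fun k => (hpos _).le) (fun k => ?_) (hs c)
    exact le_mul_of_one_le_left (hpos _).le (by linarith [k.cast_nonneg (α := ℝ)])
  set Z := ∑' s, weight lam mu theta s
  have hZ : 0 < Z := hW.tsum_pos (fun s => (hpos s).le) (busy, 0) (hpos _)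
  refine ⟨fun s => weight lam mu theta s / Z, fun s => div_pos (hpos s) hZ, ?_, ?_, ?_, ?_⟩
  · exact div_self hZ.ne' ▸ hW.hasSum.div_const Z
  · intro k
    simp only [weight, busy, idle]
    simp only [if_true, one_ne_zero, if_false]
    field_simp
  · intro k
    simp only [weight, busy, idle]
    simp only [if_true, one_ne_zero, if_false, idleWeight]
    field_simp
  · intro c
    refine Summable.of_nonneg_of_le (fun k => ?_) (fun k => ?_) ((hs c).div_const Z)
    · have := hpos (c, k)
      positivity
    · have := hpos (c, k)
      rw [← mul_div_assoc]
      gcongr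
      linarith

/-! ### Tail sums and the linear system for them. -/

/-- For a nonnegative sequence `a` with tails `T k = ∑_{j ≥ k} a j`, summation by parts:
`∑_{i > k} T i = ∑_{j ≥ k} j a j - k T k`. -/
lemma hasSum_tail {a : ℕ → ℝ} (ha : ∀ n, 0 ≤ a n) (hs : Summable a)
    (hs' : Summable fun n : ℕ => (n : ℝ) * a n) (k : ℕ) :
    HasSum (fun i => ∑' j, a (k + 1 + i + j))
      ((∑' j, ((k + j : ℕ) : ℝ) * a (k + j)) - k * ∑' j, a (k + j)) := by
  have hsh : ∀ {b : ℕ → ℝ}, Summable b → ∀ m, Summable fun j => b (m + j) := fun {b} hb m =>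
    ((summable_nat_add_iff m).2 hb).congr fun j => by rw [add_comm]
  have hstep : ∀ {b : ℕ → ℝ}, Summable b → ∀ m, ∑' j, b (m + j) = b m + ∑' j, b (m + 1 + j) :=
    fun {b} hb m => by
      rw [(hsh hb m).tsum_eq_zero_add]
      simp only [add_zero, add_assoc, add_comm 1]
  have hlim : ∀ {b : ℕ → ℝ}, Summable b → Tendsto (fun m => ∑' j, b (m + j)) atTop (𝓝 0) :=
    fun {b} hb => (tendsto_sum_nat_add b).congr fun m => by simp only [add_comm]
  set T : ℕ → ℝ := fun m => ∑' j, a (m + j) with hT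
  set V : ℕ → ℝ := fun m => ∑' j, ((m + j : ℕ) : ℝ) * a (m + j) with hV
  have hTs : ∀ m, T m = a m + T (m + 1) := hstep hs
  have hVs : ∀ m : ℕ, V m = m * a m + V (m + 1) := hstep hs'
  have hVlim : Tendsto V atTop (𝓝 0) := hlim hs'
  have hT0 : ∀ m, 0 ≤ T m := fun m => tsum_nonneg fun j => ha _
  have hVT : ∀ m : ℕ, m * T m ≤ V m := fun m => by
    rw [hT, hV]
    simp only
    rw [← tsum_mul_left]
    refine Summable.tsum_le_tsum (fun j => ?_) ((hsh hs m).mul_left _) (hsh hs' m)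
    have := ha (m + j)
    gcongr
    simp
  -- The boundary term of the summation by parts is squeezed by the tail of the first-moment series.
  have hmT : Tendsto (fun m : ℕ => (m : ℝ) * T m) atTop (𝓝 0) :=
    squeeze_zero (fun m => by have := hT0 m; positivity) hVT hVlim
  rw [hasSum_iff_tendsto_nat_of_nonneg (fun i => hT0 _)]
  have hpart : ∀ n, ∑ i ∈ Finset.range n, T (k + 1 + i)
      = (V k - k * T k) - (V (n + k) - ((n + k : ℕ) : ℝ) * T (n + k)) := by
    intro n
    induction n with
    | zero => simp
    | succ n ih =>
      rw [Finset.sum_range_succ, ih, hVs (n + k), hTs (n + k),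
        show k + 1 + n = n + k + 1 by ring, show n + 1 + k = n + k + 1 by ring]
      push_cast
      ring
  have h := (tendsto_const_nhds (x := V k - k * T k)).sub
    (((hVlim.sub hmT).comp (tendsto_add_atTop_nat k)))
  simp only [sub_zero] at h
  exact h.congr fun n => (hpart n).symm

lemma vecMul_fin_two (v : Fin 2 → ℝ) (M : Block) :
    v ᵥ* M = ![v 0 * M 0 0 + v 1 * M 1 0, v 0 * M 0 1 + v 1 * M 1 1] := by
  ext c
  fin_cases c <;> simp [Matrix.vecMul, dotProduct, Fin.sum_univ_two]

namespace IsStationary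

variable {lam mu theta : ℝ} {x : State → ℝ}

lemma summable (h : IsStationary lam mu theta x) (c : Fin 2) : Summable fun k : ℕ => x (c, k) :=
  h.hasSum.summable.comp_injective (i := fun k : ℕ => (c, k)) fun _ _ h => (Prod.ext_iff.1 h).2

lemma summable_add (h : IsStationary lam mu theta x) (c : Fin 2) (m : ℕ) :
    Summable fun k : ℕ => x (c, m + k) :=
  ((summable_nat_add_iff m).2 (h.summable c)).congr fun j => by rw [add_comm]

lemma tailPair_pos (h : IsStationary lam mu theta x) (k : ℕ) (c : Fin 2) : 0 < tailPair x k c :=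
  (h.summable_add c k).tsum_pos (fun _ => (h.pos _).le) 0 (h.pos _)

lemma tailPair_succ (h : IsStationary lam mu theta x) (k : ℕ) (c : Fin 2) :
    tailPair x k c = x (c, k) + tailPair x (k + 1) c := by
  rw [tailPair, (h.summable_add c k).tsum_eq_zero_add, tailPair]
  simp only [add_zero, add_assoc, add_comm 1]

lemma hasSum_tailPair (h : IsStationary lam mu theta x) (k : ℕ) (c : Fin 2) :
    HasSum (fun i => tailPair x (k + 1 + i) c)
      ((∑' j, ((k + j : ℕ) : ℝ) * x (c, k + j)) - k * tailPair x k c) :=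
  hasSum_tail (fun _ => (h.pos _).le) (h.summable c) (h.summable_mul c) k

lemma summable_tailPair (h : IsStationary lam mu theta x) (k : ℕ) (c : Fin 2) :
    Summable (fun i => tailPair x (k + i) c) := by
  rw [← summable_nat_add_iff 1]
  exact (h.hasSum_tailPair k c).summable.congr fun i => by rw [add_assoc, add_comm 1 i]

/-- The retrials out of the levels above `k` balance the arrivals to the orbit at levels `≥ k`. -/
lemma cut_tail (h : IsStationary lam mu theta x) (k : ℕ) :
    theta * (((k : ℝ) + 1) * tailPair x (k + 1) idle + ∑' i, tailPair x (k + 2 + i) idle)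
      = lam * tailPair x k busy := by
  have h1 := (h.hasSum_tailPair (k + 1) idle).tsum_eq
  rw [show k + 2 = k + 1 + 1 from rfl, h1, tailPair, tailPair, ← tsum_mul_left (a := lam)]
  push_cast
  rw [add_sub_cancel, ← tsum_mul_left]
  refine tsum_congr fun j => ?_
  rw [← h.cut (k + j), show k + 1 + j = k + j + 1 by ring]
  push_cast
  ring

/-- The balance equations are summed over the levels from `k` on; summation by parts turns the first
moment into a series of tails. -/
lemma balance_tail (h : IsStationary lam mu theta x) (k : ℕ) :
    mu * tailPair x k busy = lam * tailPair x k idle +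
      theta * (k * tailPair x k idle + ∑' i, tailPair x (k + 1 + i) idle) := by
  have h1 := (h.hasSum_tailPair k idle).tsum_eq
  have hs : Summable fun j : ℕ => ((k + j : ℕ) : ℝ) * x (idle, k + j) :=
    ((summable_nat_add_iff k).2 (h.summable_mul idle)).congr fun j => by rw [add_comm]
  rw [h1, add_sub_cancel, tailPair, tailPair, ← tsum_mul_left, ← tsum_mul_left, ← tsum_mul_left,
    ← Summable.tsum_add ((h.summable_add idle k).mul_left _) (hs.mul_left _)]
  refine tsum_congr fun j => ?_
  rw [h.balance]
  push_cast
  ring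

/-- At level zero the retrial terms of `balance_tail` and `cut_tail` coincide, so services balance
all arrivals: `μ π_{W,0} = λ (π_{I,0} + π_{W,0}) = λ`. -/
lemma tailPair_zero (h : IsStationary lam mu theta x) (hmu : 0 < mu) :
    tailPair x 0 = ![lam / mu, 1 - lam / mu] := by
  have h1 : tailPair x 0 busy + tailPair x 0 idle = 1 := by
    have := h.hasSum.summable.tsum_prod' (fun c => h.summable c)
    rw [h.hasSum.tsum_eq, tsum_fintype, Fin.sum_univ_two] at this
    simp only [tailPair, zero_add]
    exact this.symm
  have h2 := h.balance_tail 0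
  have h3 := h.cut_tail 0
  have h4 : ∑' i, tailPair x (0 + 1 + i) idle
      = tailPair x 1 idle + ∑' i, tailPair x (0 + 2 + i) idle := by
    rw [(h.summable_tailPair (0 + 1) idle).tsum_eq_zero_add]
    simp only [zero_add, add_comm, add_left_comm]
  rw [h4] at h2
  simp only [CharP.cast_eq_zero, zero_add, zero_mul, one_mul] at h2 h3
  have hW : tailPair x 0 busy = lam / mu := by
    rw [eq_div_iff hmu.ne']
    linear_combination h2 + h3 + lam * h1
  have hI : tailPair x 0 idle = 1 - lam / mu := by linarith
  ext c
  fin_cases c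
  · exact hW
  · exact hI

/-- The tail vectors solve the linear system `Π Q = (-λρ, 0, 0, …)`. -/
lemma hasSum_tailPair_vecMul_Q (h : IsStationary lam mu theta x) (hmu : 0 < mu) (j : ℕ) :
    HasSum (fun i : ℕ => tailPair x (i + 1) ᵥ* Q lam mu theta i j)
      (if j = 0 then ![-(lam * (lam / mu)), 0] else 0) := by
  have hE := (h.summable_tailPair (j + 1 + 2) idle).hasSum
  set E := ∑' i, tailPair x (j + 1 + 2 + i) idle with hEdef
  have hcut := h.cut_tail (j + 1)
  have hcut' := h.cut_tail j
  have hbal := h.balance_tail (j + 1)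
  have hE1 : ∑' i, tailPair x (j + 1 + 1 + i) idle = tailPair x (j + 1 + 1) idle + E := by
    rw [(h.summable_tailPair (j + 1 + 1) idle).tsum_eq_zero_add, hEdef]
    congr 1
    exact tsum_congr fun i => by congr 1; ring
  rw [← hEdef] at hcut
  rw [show j + 2 = j + 1 + 1 from rfl, hE1] at hcut'
  rw [hE1] at hbal
  push_cast at hcut hcut' hbal
  -- From row `j + 2` on every block of the column is `D`, so the infinite part is a series of
  -- tails; the first `j + 2` rows form a finite sum.
  have htail : HasSum (fun i => tailPair x (i + (j + 2) + 1) ᵥ* Q lam mu theta (i + (j + 2)) j)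
      ![theta * E, -theta * E] := by
    have hQ : ∀ i, Q lam mu theta (i + (j + 2)) j = blockD theta := fun i => by
      unfold Q
      rw [if_neg (by omega), if_neg (by omega), if_neg (by omega), if_pos (by omega)]
    have hi : ∀ i, i + (j + 2) + 1 = j + 1 + 2 + i := fun i => by ring
    rw [Pi.hasSum]
    simp only [hQ, hi]
    intro c
    fin_cases c
    · simpa [blockD, Matrix.vecMul, dotProduct, Fin.sum_univ_two, mul_comm] using hE.mul_left theta
    · simpa [blockD, Matrix.vecMul, dotProduct, Fin.sum_univ_two, mul_comm]
        using (hE.mul_left theta).neg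
  suffices hfin : (if j = 0 then ![-(lam * (lam / mu)), 0] else 0) -
      ∑ i ∈ Finset.range (j + 2), tailPair x (i + 1) ᵥ* Q lam mu theta i j
      = ![theta * E, -theta * E] by
    rw [← hasSum_nat_add_iff' (j + 2), hfin]
    exact htail
  rw [Finset.sum_range_succ, Finset.sum_range_succ]
  have hQ1 : Q lam mu theta (j + 1) j = blockB theta (j + 2) := by
    unfold Q
    rw [if_neg (by omega), if_neg (by omega), if_pos (by omega)]
  have hQ0 : Q lam mu theta j j = blockA lam mu theta (j + 1) := by
    unfold Q
    rw [if_neg (by omega), if_pos rfl]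
  rw [hQ1, hQ0]
  -- The first column has no block `C` above the diagonal; the missing term `λ π_{W,0} = λρ` becomes
  -- the right-hand side.
  cases j with
  | zero =>
    have h0 := congrFun (h.tailPair_zero hmu) busy
    simp only [Matrix.cons_val_zero] at h0
    ext c
    fin_cases c
    · simp only [vecMul_fin_two]; simp [blockA, blockB]
      simp at hcut hcut' hbal
      rw [h0] at hcut'
      linear_combination hbal - hcut + hcut'
    · simp only [vecMul_fin_two]; simp [blockA, blockB]
      simp at hcut hcut' hbal
      linear_combination -hbal
  | succ j =>
    have hQ2 : Q lam mu theta j (j + 1) = blockC lam := by simp [Q]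
    rw [Finset.sum_range_succ, hQ2, Finset.sum_eq_zero fun i hi => ?_]
    · ext c
      fin_cases c
      · simp only [vecMul_fin_two]; simp [blockA, blockB, blockC]
        push_cast at hcut hcut' hbal
        linear_combination hbal - hcut + hcut'
      · simp only [vecMul_fin_two]; simp [blockA, blockB, blockC]
        push_cast at hcut hcut' hbal
        linear_combination -hbal
    · rw [Finset.mem_range] at hi
      unfold Q
      rw [if_neg (by omega), if_neg (by omega), if_neg (by omega), if_neg (by omega),
        Matrix.vecMul_zero]

end IsStationary

/-! ### Uniqueness of the solution of the `R`-system. -/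

lemma eq_zero_of_succ_eq_of_tendsto_zero {u : ℕ → ℝ} (h : ∀ n, u (n + 1) = u n)
    (hu : Tendsto u atTop (𝓝 0)) (n : ℕ) : u n = 0 := by
  have h0 : ∀ m, u m = u 0 := fun m => by
    induction m with
    | zero => rfl
    | succ m ih => rw [h, ih]
  have : Tendsto u atTop (𝓝 (u 0)) := tendsto_const_nhds.congr fun m => (h0 m).symm
  rw [h0, tendsto_nhds_unique this hu]

lemma prodR_succ_left (R : ℕ → Block) (k l : ℕ) :
    prodR R k (l + 1) = R k * prodR R (k + 1) l := by
  induction l with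
  | zero => simp [prodR]
  | succ l ih =>
    rw [prodR, ih, prodR, mul_assoc, show k + (l + 1) = k + 1 + l by ring]

lemma prodR_add (R : ℕ → Block) (k l m : ℕ) :
    prodR R k (l + m) = prodR R k l * prodR R (k + l) m := by
  induction m with
  | zero => simp [prodR]
  | succ m ih => rw [← add_assoc, prodR, ih, prodR, mul_assoc, add_assoc]

/-- Every product has first factor `R k`; the summand `1` is the empty remaining product. This
recursion drives the factorization of `Q`. -/
lemma sumR_eq (R : ℕ → Block) (k : ℕ)
    (h : Summable fun l : ℕ => prodR R (k + 1) (l + 1)) :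
    HasSum (fun l : ℕ => prodR R k (l + 1)) (R k * (1 + sumR R (k + 1))) := by
  simp_rw [prodR_succ_left R k]
  refine HasSum.mul_left _ ?_
  rw [← hasSum_nat_add_iff' 1]
  simpa [prodR, sumR] using h.hasSum

lemma hasSum_vecMul {f : ℕ → Block} {M : Block} (h : HasSum f M) (v : Fin 2 → ℝ) :
    HasSum (fun l => v ᵥ* f l) (v ᵥ* M) :=
  h.map ({ toFun := fun N => v ᵥ* N
           map_zero' := Matrix.vecMul_zero v
           map_add' := fun A B => Matrix.vecMul_add A B v } : Block →+ (Fin 2 → ℝ))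
    (continuous_const.matrix_vecMul continuous_id)

/-- The candidate for the `R`-measure, in terms of the tails of the stationary distribution. -/
noncomputable def tailRatio (x : State → ℝ) (k : ℕ) : Block :=
  !![tailPair x (k + 1) busy / tailPair x k busy, tailPair x (k + 1) idle / tailPair x k busy; 0, 0]

namespace IsStationary

variable {lam mu theta : ℝ} {x : State → ℝ}

/-- A null sequence of row vectors that solves the columns `≥ k + 1` of the linear system is a
multiple of the sequence of tails of the stationary distribution. -/
lemma eq_smul_tailPair_of_recurrence (h : IsStationary lam mu theta x)
    (hmu : 0 < mu) (htheta : 0 < theta) (k : ℕ) {w i e : ℕ → ℝ}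
    (hW : ∀ l : ℕ, lam * w l - (lam + mu) * w (l + 1) + lam * i (l + 1)
      + ((k : ℝ) + l + 2) * theta * i (l + 2) + theta * e l = 0)
    (hI : ∀ l : ℕ, mu * w (l + 1) - (lam + ((k : ℝ) + l + 1) * theta) * i (l + 1)
      - theta * i (l + 2) - theta * e l = 0)
    (he : ∀ l, e l = i (l + 3) + e (l + 1))
    (hw0 : Tendsto w atTop (𝓝 0)) (hi0 : Tendsto i atTop (𝓝 0)) (l : ℕ) :
    w l = w 0 / tailPair x k busy * tailPair x (k + l) busy ∧
      i (l + 1) = w 0 / tailPair x k busy * tailPair x (k + l + 1) idle := by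
  set β := (w 0 - w 1) / x (busy, k) with hβ
  have hxpos : 0 < x (busy, k) := h.pos _
  have hlim : ∀ c, Tendsto (fun n => tailPair x (k + n) c) atTop (𝓝 0) := fun c =>
    (h.summable_tailPair k c).tendsto_atTop_zero
  have hy : ∀ n, w n - w (n + 1) = β * x (busy, k + n) ∧
      i (n + 1) - i (n + 2) = β * x (idle, k + n + 1) := by
    -- Adding the two columns cancels the series `e` and leaves the cut equation for the
    -- differences.
    have key : ∀ n, w n - w (n + 1) = β * x (busy, k + n) →
        i (n + 1) - i (n + 2) = β * x (idle, k + n + 1) := by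
      intro n hn
      have hc := h.cut (k + n)
      push_cast at hc
      have hp : 0 < ((k : ℝ) + n + 1) * theta := by positivity
      apply mul_left_cancel₀ hp.ne'
      linear_combination (-1 : ℝ) * hW n - hI n + lam * hn - β * hc
    intro n
    induction n with
    | zero =>
      have h0 : w 0 - w (0 + 1) = β * x (busy, k + 0) := by
        rw [hβ, add_zero, div_mul_cancel₀ _ hxpos.ne']
      exact ⟨h0, key 0 h0⟩
    | succ n ih =>
      -- Subtracting consecutive idle columns and using `he` leaves the balance equation for the
      -- differences.
      have h1 : w (n + 1) - w (n + 1 + 1) = β * x (busy, k + (n + 1)) := by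
        apply mul_left_cancel₀ hmu.ne'
        have h2 := h.balance (k + (n + 1))
        have h3 := hI (n + 1)
        push_cast at h2 h3
        have h4 := ih.2
        rw [show k + n + 1 = k + (n + 1) by ring] at h4
        linear_combination hI n - h3 + theta * he n - β * h2
          + (lam + ((k : ℝ) + n + 1) * theta) * h4
      exact ⟨h1, key _ h1⟩
  have hw : ∀ n, w n = β * tailPair x (k + n) busy := by
    intro n
    rw [← sub_eq_zero]
    refine eq_zero_of_succ_eq_of_tendsto_zero (u := fun n => w n - β * tailPair x (k + n) busy)
      (fun m => ?_) (by simpa using hw0.sub ((hlim busy).const_mul β)) n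
    have := h.tailPair_succ (k + m) busy
    simp only [← add_assoc]
    linear_combination (-1 : ℝ) * (hy m).1 + β * this
  have hi : ∀ n, i (n + 1) = β * tailPair x (k + (n + 1)) idle := by
    intro n
    rw [← sub_eq_zero]
    refine eq_zero_of_succ_eq_of_tendsto_zero
      (u := fun n => i (n + 1) - β * tailPair x (k + (n + 1)) idle) (fun m => ?_) ?_ n
    · have := h.tailPair_succ (k + m + 1) idle
      simp only [← add_assoc]
      linear_combination (-1 : ℝ) * (hy m).2 + β * this
    · simpa using ((tendsto_add_atTop_iff_nat 1).2 hi0).sub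
        (((tendsto_add_atTop_iff_nat 1).2 (hlim idle)).const_mul β)
  have hα : w 0 / tailPair x k busy = β := by
    rw [hw 0, add_zero, mul_div_cancel_right₀ _ (h.tailPair_pos k busy).ne']
  rw [hα]
  exact ⟨hw l, hi l⟩

/-- The system for the `R`-measure has at most one solution for which the series converge. -/
lemma eq_tailRatio_of_isNonnegSolution (h : IsStationary lam mu theta x)
    (hmu : 0 < mu) (htheta : 0 < theta) {S : ℕ → Block} (hS : IsNonnegSolution lam mu theta S)
    {k : ℕ} (hk : 1 ≤ k) : S k = tailRatio x k := by
  have key : ∀ u : Fin 2 → ℝ, u ᵥ* S k =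
      ![u 0 / tailPair x k busy * tailPair x (k + 1) busy,
        u 0 / tailPair x k busy * tailPair x (k + 1) idle] := by
    intro u
    set v : ℕ → Fin 2 → ℝ := fun l => u ᵥ* prodR S k l with hv
    have hvs : ∀ l, v l ᵥ* S (k + l) = v (l + 1) := fun l => by
      simp only [hv, prodR, Matrix.vecMul_vecMul]
    have hsum : ∀ l, HasSum (fun m => v (l + 3 + m)) (v (l + 2) ᵥ* sumR S (k + l + 2)) := by
      intro l
      have h1 := hasSum_vecMul (hS (k + l) (by omega)).2.1.hasSum (v (l + 2))
      have h2 : (fun m => v (l + 3 + m))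
          = fun m => v (l + 2) ᵥ* prodR S (k + l + 2) (m + 1) := by
        funext m
        simp only [hv, Matrix.vecMul_vecMul]
        rw [show k + l + 2 = k + (l + 2) by ring, ← prodR_add,
          show l + 2 + (m + 1) = l + 3 + m by ring]
      rw [h2]
      exact h1
    -- The terms of a convergent series tend to zero; the first series at hand starts with `v 3`.
    have hvlim : Tendsto v atTop (𝓝 0) := by
      rw [← tendsto_add_atTop_iff_nat 3]
      exact (hsum 0).summable.tendsto_atTop_zero.congr fun m => by congr 1; ring
    set e : ℕ → ℝ := fun l => (v (l + 2) ᵥ* sumR S (k + l + 2)) 1 with he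
    have hmain : ∀ l, v l ᵥ* blockC lam + v (l + 1) ᵥ* blockA lam mu theta (k + l + 1)
        + v (l + 2) ᵥ* blockB theta (k + l + 2)
        + (v (l + 2) ᵥ* sumR S (k + l + 2)) ᵥ* blockD theta = 0 := by
      intro l
      have h1 := congrArg (fun M => v l ᵥ* M) (hS (k + l) (by omega)).2.2
      simp only [Matrix.vecMul_add, ← Matrix.vecMul_vecMul, Matrix.vecMul_zero] at h1
      rwa [hvs, show k + l + 1 = k + (l + 1) by ring, hvs] at h1
    have hres := h.eq_smul_tailPair_of_recurrence hmu htheta k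
      (w := fun l => v l 0) (i := fun l => v l 1) (e := e) ?_ ?_ ?_
      (by simpa using (tendsto_pi_nhds.1 hvlim) 0) (by simpa using (tendsto_pi_nhds.1 hvlim) 1)
    · have hu : v 0 = u := by simp [hv, prodR]
      have h1 : u ᵥ* S k = v 1 := by rw [← hvs 0, hu, add_zero]
      rw [h1]
      have hr0 := (hres 1).1
      have hr1 := (hres 0).2
      rw [hu] at hr0 hr1
      ext c
      fin_cases c
      · exact hr0
      · exact hr1
    · intro l
      have := congrFun (hmain l) 0
      simp only [vecMul_fin_two _ (blockC _), vecMul_fin_two _ (blockA _ _ _ _),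
        vecMul_fin_two _ (blockB _ _), vecMul_fin_two _ (blockD _)] at this
      simp [blockA, blockB, blockC, blockD] at this
      simp only [he]
      linear_combination this
    · intro l
      have := congrFun (hmain l) 1
      simp only [vecMul_fin_two _ (blockC _), vecMul_fin_two _ (blockA _ _ _ _),
        vecMul_fin_two _ (blockB _ _), vecMul_fin_two _ (blockD _)] at this
      simp [blockA, blockB, blockC, blockD] at this
      simp only [he]
      linear_combination this
    · intro l
      have h1 := hsum l
      have h2 := hsum (l + 1)
      have h3 := (hasSum_nat_add_iff' 1).2 h1
      simp only [Finset.sum_range_one, add_zero] at h3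
      have h4 : (fun m => v (l + 3 + (m + 1))) = fun m => v (l + 1 + 3 + m) := by
        funext m; congr 1; ring
      rw [h4] at h3
      have h5 := congrFun (h3.unique h2) 1
      simp only [he]
      simp only [Pi.sub_apply] at h5
      linarith
  have hpos := h.tailPair_pos k busy
  ext a b
  -- Unit vectors read off the rows. The second one has busy coordinate zero, which makes the second
  -- row of `S k` vanish.
  have h1 := congrFun (key (Pi.single a 1)) b
  rw [Matrix.single_one_vecMul] at h1
  simp only [Matrix.row] at h1
  rw [h1]
  fin_cases a <;> fin_cases b <;> simp [tailRatio] <;> field_simp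

end IsStationary

/-! ### Closed forms for the `R`-measure and the matrices `Ψ_k`. -/

namespace IsStationary

variable {lam mu theta : ℝ} {x : State → ℝ} {R : ℕ → Block}

/-- Since the second rows vanish, only the busy ratios multiply, and they telescope. -/
lemma prodR_tailRatio (h : IsStationary lam mu theta x) (hR : ∀ k, 1 ≤ k → R k = tailRatio x k)
    {k : ℕ} (hk : 1 ≤ k) (l : ℕ) :
    prodR R k (l + 1) = !![tailPair x (k + 1 + l) busy / tailPair x k busy,
      tailPair x (k + 1 + l) idle / tailPair x k busy; 0, 0] := by
  induction l with
  | zero => simp [prodR, hR k hk, tailRatio]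
  | succ l ih =>
    have h1 := h.tailPair_pos k busy
    have h2 := h.tailPair_pos (k + 1 + l) busy
    rw [prodR, ih, hR _ (by omega), tailRatio, show k + (l + 1) = k + 1 + l by ring,
      show k + 1 + (l + 1) = k + 1 + l + 1 by ring]
    ext a b
    fin_cases a <;> fin_cases b <;> simp [Matrix.mul_apply, Fin.sum_univ_two] <;> field_simp

lemma hasSum_prodR (h : IsStationary lam mu theta x) (hR : ∀ k, 1 ≤ k → R k = tailRatio x k)
    {k : ℕ} (hk : 1 ≤ k) :
    HasSum (fun l => prodR R k (l + 1))
      !![(∑' i, tailPair x (k + 1 + i) busy) / tailPair x k busy,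
        (∑' i, tailPair x (k + 1 + i) idle) / tailPair x k busy; 0, 0] := by
  simp_rw [h.prodR_tailRatio hR hk]
  refine Pi.hasSum.2 fun a => Pi.hasSum.2 fun b => ?_
  fin_cases a <;> fin_cases b
  · simpa using (h.summable_tailPair (k + 1) busy).hasSum.div_const _
  · simpa using (h.summable_tailPair (k + 1) idle).hasSum.div_const _
  · simp
  · simp

lemma sumR_tailRatio (h : IsStationary lam mu theta x) (hR : ∀ k, 1 ≤ k → R k = tailRatio x k)
    {k : ℕ} (hk : 1 ≤ k) :
    sumR R k = !![(∑' i, tailPair x (k + 1 + i) busy) / tailPair x k busy,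
        (∑' i, tailPair x (k + 1 + i) idle) / tailPair x k busy; 0, 0] :=
  (h.hasSum_prodR hR hk).tsum_eq

/-- The series of idle tails in `Ψ_k` is eliminated by `cut_tail` at level `k`. -/
lemma Psi_tailRatio (h : IsStationary lam mu theta x) (hR : ∀ k, 1 ≤ k → R k = tailRatio x k)
    {k : ℕ} (hk : 1 ≤ k) :
    Psi lam mu theta R k =
      !![-mu, mu - lam + k * theta * (tailPair x (k + 1) idle / tailPair x k busy);
        lam, -(lam + k * theta)] := by
  have h1 := h.tailPair_pos k busy
  have h2 := h.tailPair_pos (k + 1) busy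
  have hcut := h.cut_tail k
  rw [Psi, h.sumR_tailRatio hR (by omega), hR k hk, tailRatio, blockA, blockB, blockD]
  simp only [show k + 1 + 1 = k + 2 from rfl]
  ext a b
  fin_cases a <;> fin_cases b <;> simp <;> field_simp
  · linear_combination hcut
  · linear_combination -hcut

/-- With `b = π_{I,k+1} / π_{W,k}` the determinant is `λ² + kθ (μ - λ b)`, and `λ b ≤ μ` because
`balance_tail` gives `λ π_{I,k} ≤ μ π_{W,k}`. -/
lemma isUnit_Psi (h : IsStationary lam mu theta x) (hlam : 0 < lam) (htheta : 0 < theta)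
    (hR : ∀ k, 1 ≤ k → R k = tailRatio x k) {k : ℕ} (hk : 1 ≤ k) :
    IsUnit (Psi lam mu theta R k) := by
  have h1 := h.tailPair_pos k busy
  have h2 := h.tailPair_pos k idle
  have hbal := h.balance_tail k
  have hE : 0 ≤ ∑' i, tailPair x (k + 1 + i) idle :=
    tsum_nonneg fun i => (h.tailPair_pos _ _).le
  have hle : tailPair x (k + 1) idle ≤ tailPair x k idle := by
    rw [h.tailPair_succ k idle]
    linarith [h.pos (idle, k)]
  have hb : lam * (tailPair x (k + 1) idle / tailPair x k busy) ≤ mu := by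
    rw [← mul_div_assoc, div_le_iff₀ h1, hbal]
    have : 0 ≤ theta * (k * tailPair x k idle + ∑' i, tailPair x (k + 1 + i) idle) := by positivity
    nlinarith
  rw [Matrix.isUnit_iff_isUnit_det, isUnit_iff_ne_zero, h.Psi_tailRatio hR hk, Matrix.det_fin_two_of]
  have hk' : 0 ≤ (k : ℝ) * theta := by positivity
  have := mul_nonneg hk' (sub_nonneg.2 hb)
  refine ne_of_gt ?_
  nlinarith [mul_pos hlam hlam]

/-- The equation of the `R`-measure in the form `C + R_k Ψ_{k+1} = 0`. -/
lemma blockC_add_mul_Psi (h : IsStationary lam mu theta x)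
    (hR : ∀ k, 1 ≤ k → R k = tailRatio x k) {k : ℕ} (hk : 1 ≤ k) :
    blockC lam + R k * Psi lam mu theta R (k + 1) = 0 := by
  have h1 := h.tailPair_pos k busy
  have h2 := h.tailPair_pos (k + 1) busy
  have hcut := h.cut_tail k
  have hbal := h.balance_tail (k + 1)
  have hE : ∑' i, tailPair x (k + 2 + i) idle
      = tailPair x (k + 2) idle + ∑' i, tailPair x (k + 2 + 1 + i) idle := by
    rw [(h.summable_tailPair (k + 2) idle).tsum_eq_zero_add]
    simp only [add_zero, add_assoc, add_comm 1]
  have hcut' := h.cut_tail (k + 1)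
  rw [h.Psi_tailRatio hR (by omega), hR k hk, tailRatio, blockC]
  simp only [show k + 1 + 1 = k + 2 from rfl, show k + 1 + 2 = k + 2 + 1 from rfl] at *
  push_cast at *
  rw [hE] at hcut hbal
  ext a b
  fin_cases a <;> fin_cases b <;> simp <;> field_simp
  · linear_combination -hbal - hcut
  · linear_combination hbal + hcut'

lemma isNonnegSolution_tailRatio (h : IsStationary lam mu theta x) :
    IsNonnegSolution lam mu theta (tailRatio x) := by
  intro k hk
  have hR : ∀ k, 1 ≤ k → tailRatio x k = tailRatio x k := fun _ _ => rfl
  have hs := (h.hasSum_prodR hR (k := k + 2) (by omega)).summable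
  refine ⟨fun a b => ?_, hs, ?_⟩
  · have h1 := (h.tailPair_pos k busy).le
    have h2 := fun c => (h.tailPair_pos (k + 1) c).le
    fin_cases a <;> fin_cases b <;> simp [tailRatio] <;> exact div_nonneg (h2 _) h1
  · rw [← h.blockC_add_mul_Psi hR hk, Psi]
    noncomm_ring

lemma isRMeasure_tailRatio (h : IsStationary lam mu theta x)
    (hmu : 0 < mu) (htheta : 0 < theta) : IsRMeasure lam mu theta (tailRatio x) :=
  ⟨h.isNonnegSolution_tailRatio, fun S hS k hk a b => by
    rw [h.eq_tailRatio_of_isNonnegSolution hmu htheta hS hk]⟩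

lemma eq_mul_neg_Psi_inv (h : IsStationary lam mu theta x) (hlam : 0 < lam)
    (htheta : 0 < theta) (hR : ∀ k, 1 ≤ k → R k = tailRatio x k) {k : ℕ} (hk : 1 ≤ k) :
    R k = blockC lam * (-Psi lam mu theta R (k + 1))⁻¹ := by
  have hu := h.isUnit_Psi hlam htheta hR (k := k + 1) (by omega)
  have h1 : blockC lam = R k * -Psi lam mu theta R (k + 1) := by
    rw [mul_neg]
    exact eq_neg_of_add_eq_zero_left (h.blockC_add_mul_Psi hR hk)
  rw [h1, Matrix.mul_nonsing_inv_cancel_right]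
  exact (Matrix.isUnit_iff_isUnit_det _).1 hu.neg

/-- The level-one tail vector: `Π_1 Ψ_1 = (-λρ, 0)`. -/
lemma tailPair_one_eq (h : IsStationary lam mu theta x) (hlam : 0 < lam) (hmu : 0 < mu)
    (htheta : 0 < theta) (hR : ∀ k, 1 ≤ k → R k = tailRatio x k) :
    tailPair x 1 = ![lam * (lam / mu), 0] ᵥ* (-(Psi lam mu theta R 1)⁻¹) := by
  have hu := h.isUnit_Psi hlam htheta hR le_rfl
  have hcut := h.cut_tail 0
  have hcut' := h.cut_tail 1
  have hbal := h.balance_tail 1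
  have hE : ∑' i, tailPair x (0 + 2 + i) idle
      = tailPair x 2 idle + ∑' i, tailPair x (1 + 2 + i) idle := by
    rw [(h.summable_tailPair (0 + 2) idle).tsum_eq_zero_add]
    simp only [add_zero, zero_add, add_assoc, add_comm 1]
  have h0 := congrFun (h.tailPair_zero hmu) busy
  simp only [Matrix.cons_val_zero] at h0
  have h1 := h.tailPair_pos 1 busy
  have h2 : tailPair x 1 ᵥ* Psi lam mu theta R 1 = -![lam * (lam / mu), 0] := by
    rw [h.Psi_tailRatio hR le_rfl, vecMul_fin_two]
    simp only [show 1 + 1 = 0 + 2 from rfl] at hbal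
    rw [hE] at hcut hbal
    rw [h0] at hcut
    simp at hcut hcut' hbal
    ext c
    fin_cases c <;> simp <;> field_simp
    · field_simp at hcut
      linear_combination -mu * hbal - hcut
    · linear_combination hbal + hcut'
  have h3 := congrArg (fun v => v ᵥ* (Psi lam mu theta R 1)⁻¹) h2
  simp only [Matrix.vecMul_vecMul] at h3
  rw [Matrix.mul_nonsing_inv _ ((Matrix.isUnit_iff_isUnit_det _).1 hu), Matrix.vecMul_one] at h3
  rw [h3, Matrix.neg_vecMul, Matrix.vecMul_neg]

/-- Only the busy coordinate of `Π_1` meets a nonzero row, and it cancels the denominator of the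
telescoped product. -/
lemma tailPair_one_vecMul_prodR (h : IsStationary lam mu theta x)
    (hR : ∀ k, 1 ≤ k → R k = tailRatio x k) (l : ℕ) :
    tailPair x (l + 2) = tailPair x 1 ᵥ* prodR R 1 (l + 1) := by
  have h1 := h.tailPair_pos 1 busy
  rw [h.prodR_tailRatio hR le_rfl, vecMul_fin_two, show 1 + 1 + l = l + 2 by ring]
  ext c
  fin_cases c <;> simp <;> field_simp

end IsStationary

/-! ### The `RG`-factorization. -/

lemma blockMul_one_sub_factorRU (R : ℕ → Block) (d : ℕ → Block) (i j : ℕ) :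
    blockMul (1 - factorRU R) (Matrix.diagonal d) i j =
      if j = i then d i else if j = i + 1 then -(R (i + 1) * d (i + 1)) else 0 := by
  rw [blockMul, tsum_eq_single j fun l hl => by rw [Matrix.diagonal_apply_ne _ hl, mul_zero],
    Matrix.diagonal_apply_eq, Matrix.sub_apply, factorRU, Matrix.one_apply]
  by_cases h1 : j = i
  · subst h1
    simp
  · by_cases h2 : j = i + 1
    · subst h2
      simp
    · simp [h1, h2, Ne.symm h1]

lemma blockMul_of_bidiagonal {d u : ℕ → Block} {M : Matrix ℕ ℕ Block}
    (hM : ∀ i j, M i j = if j = i then d i else if j = i + 1 then u i else 0)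
    (N : Matrix ℕ ℕ Block) (i j : ℕ) :
    blockMul M N i j = d i * N i j + u i * N (i + 1) j := by
  rw [blockMul, tsum_eq_sum (s := {i, i + 1}) fun l hl => by
      simp only [Finset.mem_insert, Finset.mem_singleton, not_or] at hl
      rw [hM, if_neg hl.1, if_neg hl.2, zero_mul],
    Finset.sum_pair (by omega), hM, hM, if_pos rfl, if_neg (by omega), if_pos rfl]

/-- The UL-type `RG`-factorization, from invertibility of the `Ψ_k`, the equation of the
`R`-measure, and the convergence of the series. -/
lemma Q_eq_blockMul {lam mu theta : ℝ} {R : ℕ → Block}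
    (hunit : ∀ k, 1 ≤ k → IsUnit (Psi lam mu theta R k))
    (heq : ∀ k, 1 ≤ k → blockC lam + R k * Psi lam mu theta R (k + 1) = 0)
    (hsum : ∀ k, 1 ≤ k → Summable fun l : ℕ => prodR R k (l + 1)) :
    Q lam mu theta = blockMul (blockMul (1 - factorRU R) (factorUD lam mu theta R))
      (1 - factorGL lam mu theta R) := by
  have hinv : ∀ k, 1 ≤ k → ∀ M, Psi lam mu theta R k * ((-Psi lam mu theta R k)⁻¹ * M) = -M := by
    intro k hk M
    rw [← neg_neg (Psi lam mu theta R k * _), ← neg_mul, Matrix.mul_nonsing_inv_cancel_left]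
    exact (Matrix.isUnit_iff_isUnit_det _).1 (hunit k hk).neg
  have hs : ∀ k, 1 ≤ k → sumR R k = R k * (1 + sumR R (k + 1)) := fun k hk =>
    (sumR_eq R k (hsum (k + 1) (by omega))).tsum_eq
  ext1 i j
  rw [factorUD, blockMul_of_bidiagonal (blockMul_one_sub_factorRU R _)]
  have h1 := hinv (i + 1) (by omega)
  have h2 := hinv (i + 1 + 1) (by omega)
  have hC := heq (i + 1) (by omega)
  have hS := hs (i + 1) (by omega)
  simp only [Matrix.sub_apply, Matrix.one_apply]
  unfold Q factorGL
  -- Strictly below the diagonal, the recursion `hS` cancels all series and leaves `D` or `B_i`; the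
  -- diagonal is the definition of `Ψ`, the superdiagonal the `R`-equation.
  rcases lt_trichotomy j (i + 1) with hj | hj | hj
  · rcases lt_trichotomy (j + 1) i with hj' | hj' | hj'
    · rw [if_neg (by omega), if_neg (by omega), if_neg (by omega), if_pos hj', if_neg (by omega),
        if_neg (by omega), if_pos hj', if_neg (by omega), if_neg (by omega), if_pos (by omega),
        Glow, Glow, zero_sub, zero_sub, mul_neg, mul_assoc, h1, neg_mul_neg, mul_assoc (R (i + 1)),
        mul_assoc (_⁻¹), h2, hS]
      noncomm_ring
    · rw [if_neg (by omega), if_neg (by omega), if_pos hj', if_neg (by omega),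
        if_pos hj', if_neg (by omega), if_neg (by omega), if_pos (by omega),
        Gsub, Glow, zero_sub, zero_sub, mul_neg, h1, neg_mul_neg, mul_assoc (R (i + 1)),
        mul_assoc (_⁻¹), h2, hS]
      noncomm_ring
    · obtain rfl : j = i := by omega
      rw [if_neg (by omega), if_pos rfl, if_pos rfl, if_neg (by omega), if_neg (by omega),
        if_neg (by omega), if_pos rfl, Gsub, zero_sub, neg_mul_neg, mul_assoc (R (j + 1)), h2, Psi]
      noncomm_ring
  · subst hj
    rw [if_pos rfl, if_neg (by omega), if_neg (by omega), if_neg (by omega), if_pos rfl,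
      if_neg (by omega), if_neg (by omega), sub_zero, sub_zero, mul_zero, zero_add, mul_one]
    exact eq_neg_of_add_eq_zero_left hC
  · rw [if_neg (by omega), if_neg (by omega), if_neg (by omega), if_neg (by omega),
      if_neg (by omega), if_neg (by omega), if_neg (by omega), if_neg (by omega),
      if_neg (by omega), if_neg (by omega)]
    simp

/-! ### Forward equations and analytic tools. -/

/-- `p` is a nonnegative solution of the forward Kolmogorov equations of total mass `m`. -/
structure IsForwardSolution (lam mu theta m : ℝ) (p : State → ℝ → ℝ) : Prop where
  nonneg : ∀ s t, 0 ≤ p s t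
  hasSum : ∀ t, HasSum (fun s => p s t) m
  continuous : ∀ s, Continuous (p s)
  hasDerivAt_busy : ∀ (k : ℕ) (t : ℝ), 0 < t → HasDerivAt (p (busy, k))
    ((if k = 0 then 0 else lam * p (busy, k - 1) t) - (lam + mu) * p (busy, k) t
      + lam * p (idle, k) t + ((k : ℝ) + 1) * theta * p (idle, k + 1) t) t
  hasDerivAt_idle : ∀ (k : ℕ) (t : ℝ), 0 < t → HasDerivAt (p (idle, k))
    (mu * p (busy, k) t - (lam + k * theta) * p (idle, k) t) t

/-- A continuous subgradient is a derivative. -/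
lemma hasDerivAt_of_subgradient {f f' : ℝ → ℝ} (hf' : Continuous f')
    (h : ∀ a b, f' a * (b - a) ≤ f b - f a) (a : ℝ) : HasDerivAt f (f' a) a := by
  rw [hasDerivAt_iff_isLittleO, Asymptotics.isLittleO_iff]
  intro ε hε
  filter_upwards [Metric.continuousAt_iff'.1 hf'.continuousAt ε hε] with b hb
  rw [Real.dist_eq] at hb
  have h1 := h a b
  have h2 := h b a
  rw [smul_eq_mul, Real.norm_eq_abs, Real.norm_eq_abs, abs_of_nonneg (by nlinarith)]
  calc f b - f a - (b - a) * f' a ≤ (f' b - f' a) * (b - a) := by linarith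
    _ ≤ |f' b - f' a| * |b - a| := by rw [← abs_mul]; exact le_abs_self _
    _ ≤ ε * |b - a| := by gcongr

/-- A smooth convex function that vanishes exactly on `(-∞, c]` and grows at most linearly. -/
noncomputable def softPos (c y : ℝ) : ℝ := max (y - c) 0 - 1 + 1 / (1 + max (y - c) 0)

noncomputable def softPosDeriv (c y : ℝ) : ℝ := 1 - 1 / (1 + max (y - c) 0) ^ 2

lemma softPos_eq_zero {c y : ℝ} (h : y ≤ c) : softPos c y = 0 := by
  simp [softPos, max_eq_right (sub_nonpos.2 h)]

lemma softPos_pos {c y : ℝ} (h : c < y) : 0 < softPos c y := by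
  have h0 : 0 < y - c := sub_pos.2 h
  rw [softPos, max_eq_left h0.le, show y - c - 1 + 1 / (1 + (y - c))
    = (y - c) ^ 2 / (1 + (y - c)) by field_simp; ring]
  positivity

lemma softPos_nonneg (c y : ℝ) : 0 ≤ softPos c y := by
  rcases le_or_gt y c with h | h
  · exact (softPos_eq_zero h).ge
  · exact (softPos_pos h).le

lemma softPos_le {c y : ℝ} (hc : 0 ≤ c) (hy : 0 ≤ y) : softPos c y ≤ y := by
  have h1 : max (y - c) 0 ≤ y := max_le (by linarith) hy
  have h2 : 1 / (1 + max (y - c) 0) ≤ 1 := by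
    rw [div_le_one (by positivity)]
    linarith [le_max_right (y - c) 0]
  rw [softPos]
  linarith

/-- In terms of the positive parts `A`, `B` the gap is the explicit nonnegative quantity `(B - A)² /
((1 + A)² (1 + B))`. -/
lemma softPosDeriv_mul_le (c a b : ℝ) :
    softPosDeriv c a * (b - a) ≤ softPos c b - softPos c a := by
  have hA : 0 ≤ max (a - c) 0 := le_max_right _ _
  have hB : 0 ≤ max (b - c) 0 := le_max_right _ _
  have h1 : softPosDeriv c a * (b - a) ≤ softPosDeriv c a * (max (b - c) 0 - max (a - c) 0) := by
    rcases le_or_gt a c with h | h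
    · simp [softPosDeriv, max_eq_right (sub_nonpos.2 h)]
    · have h2 : 0 ≤ softPosDeriv c a := by
        rw [softPosDeriv, sub_nonneg, div_le_one (by positivity)]
        nlinarith
      rw [max_eq_left (sub_pos.2 h).le]
      exact mul_le_mul_of_nonneg_left (by linarith [le_max_left (b - c) 0]) h2
  refine h1.trans (sub_nonneg.1 ?_)
  rw [softPos, softPos, softPosDeriv]
  set A := max (a - c) 0
  set B := max (b - c) 0
  rw [show B - 1 + 1 / (1 + B) - (A - 1 + 1 / (1 + A)) - (1 - 1 / (1 + A) ^ 2) * (B - A)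
    = (B - A) ^ 2 / ((1 + A) ^ 2 * (1 + B)) by field_simp; ring]
  positivity

lemma hasDerivAt_softPos (c y : ℝ) : HasDerivAt (softPos c) (softPosDeriv c y) y := by
  refine hasDerivAt_of_subgradient ?_ (softPosDeriv_mul_le c) y
  unfold softPosDeriv
  have h : ∀ y : ℝ, (1 + max (y - c) 0) ^ 2 ≠ 0 := fun y => by
    have := le_max_right (y - c) 0
    positivity
  fun_prop (disch := exact h _)

/-- A bounded function with bounded derivative and bounded energy tends to zero. -/
lemma tendsto_zero_of_integral_sq_le {q q' : ℝ → ℝ} {B L K : ℝ} (hq : Continuous q)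
    (hderiv : ∀ t, 0 < t → HasDerivAt q (q' t) t) (hB : ∀ t, 0 < t → |q t| ≤ B)
    (hL : ∀ t, 0 < t → |q' t| ≤ L) (hK : ∀ t, 0 ≤ t → ∫ s in (0 : ℝ)..t, q s ^ 2 ≤ K) :
    Tendsto q atTop (𝓝 0) := by
  have hB0 : 0 ≤ B := (abs_nonneg _).trans (hB 1 one_pos)
  have hint : IntegrableOn (fun s => q s ^ 2) (Set.Ioi 0) := by
    refine integrableOn_Ioi_of_intervalIntegral_norm_bounded (b := fun t : ℝ => t) (l := atTop) K 0
      (fun t => ?_) tendsto_id ?_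
    · exact ((hq.pow 2).integrableOn_Icc (a := 0) (b := t)).mono_set Set.Ioc_subset_Icc_self
    · filter_upwards [eventually_ge_atTop 0] with t ht
      simpa using hK t ht
  have hd : ∀ t ∈ Set.Ioi (0 : ℝ), HasDerivAt (fun t => q t ^ 4) (deriv (fun t => q t ^ 4) t) t :=
    fun t ht => ((hderiv t ht).pow 4).differentiableAt.hasDerivAt
  have h4 : Tendsto (fun t => q t ^ 4) atTop (𝓝 0) := by
    -- Both `q ^ 4` and its derivative `4 q³ q'` are bounded by constant multiples of the integrable
    -- `q ^ 2`.
    refine tendsto_zero_of_hasDerivAt_of_integrableOn_Ioi (a := 0) hd ?_ ?_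
    · refine Integrable.mono' (hint.const_mul (4 * B * L))
        (stronglyMeasurable_deriv _).aestronglyMeasurable ?_
      filter_upwards [ae_restrict_mem measurableSet_Ioi] with t ht
      have h1 : deriv (fun t => q t ^ 4) t = 4 * q t ^ 3 * q' t :=
        ((hderiv t ht).pow 4).deriv.trans (by norm_num)
      rw [h1, Real.norm_eq_abs, show 4 * q t ^ 3 * q' t = (4 * q t * q' t) * q t ^ 2 by ring,
        abs_mul, abs_of_nonneg (sq_nonneg (q t)), abs_mul, abs_mul, abs_of_nonneg (by norm_num)]
      gcongr
      · exact hB t ht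
      · exact hL t ht
    · refine Integrable.mono' (hint.const_mul (B ^ 2))
        (hq.pow 4).aestronglyMeasurable ?_
      filter_upwards [ae_restrict_mem measurableSet_Ioi] with t ht
      rw [Real.norm_eq_abs, show q t ^ 4 = q t ^ 2 * q t ^ 2 by ring, abs_mul,
        abs_of_nonneg (sq_nonneg (q t))]
      refine mul_le_mul_of_nonneg_right ?_ (sq_nonneg _)
      exact sq_le_sq' (abs_le.1 (hB t ht)).1 (abs_le.1 (hB t ht)).2
  rw [tendsto_zero_iff_abs_tendsto_zero]
  have h5 := ((Real.continuous_sqrt.comp Real.continuous_sqrt).tendsto 0).comp h4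
  simp only [Function.comp_def, Real.sqrt_zero] at h5
  refine h5.congr fun t => ?_
  rw [show q t ^ 4 = (q t ^ 2) ^ 2 by ring, Real.sqrt_sq (sq_nonneg _), Real.sqrt_sq_eq_abs]
  rfl

/-- Otherwise the sequence would eventually dominate a multiple of the harmonic series. -/
lemma exists_ge_mul_lt_of_summable {a : ℕ → ℝ} (hs : Summable a) {ε : ℝ}
    (hε : 0 < ε) (N : ℕ) : ∃ n, N ≤ n ∧ ((n : ℝ) + 1) * a (n + 1) < ε := by
  by_contra! hcon
  have h1 : Summable fun n : ℕ => a (n + (N + 1)) / ε :=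
    ((summable_nat_add_iff (N + 1)).2 hs).div_const ε
  have h2 : Summable fun n : ℕ => (((n + (N + 1) : ℕ) : ℝ))⁻¹ := by
    refine Summable.of_nonneg_of_le (fun n => by positivity) (fun n => ?_) h1
    have h3 := hcon (n + N) (by omega)
    rw [inv_le_iff_one_le_mul₀ (by positivity), div_mul_eq_mul_div, le_div_iff₀ hε, one_mul]
    push_cast at h3 ⊢
    rw [show n + (N + 1) = n + N + 1 by ring]
    linarith
  exact Real.not_summable_natCast_inv ((summable_nat_add_iff (N + 1)).1 h2)

/-! ### The energy inequality. -/

/-- The weighted `φ`-energy of the density `p / x` on the levels `≤ n`. -/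
noncomputable def energy (x : State → ℝ) (p : State → ℝ → ℝ) (φ : ℝ → ℝ) (n : ℕ) (t : ℝ) : ℝ :=
  ∑ k ∈ Finset.range (n + 1), (x (busy, k) * φ (p (busy, k) t / x (busy, k))
    + x (idle, k) * φ (p (idle, k) t / x (idle, k)))

/-- The dissipation of the energy on the levels `≤ n`. -/
noncomputable def dissipation (lam mu : ℝ) (x : State → ℝ) (p : State → ℝ → ℝ) (n : ℕ)
    (t : ℝ) : ℝ :=
  ∑ k ∈ Finset.range (n + 1),
    (mu * x (busy, k) * (p (busy, k) t / x (busy, k) - p (idle, k) t / x (idle, k)) ^ 2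
    + lam * x (busy, k) * (p (idle, k + 1) t / x (idle, k + 1) - p (busy, k) t / x (busy, k)) ^ 2)

namespace IsForwardSolution

variable {lam mu theta m : ℝ} {x : State → ℝ} {p : State → ℝ → ℝ}

/-- The density follows the backward equation of the time-reversed chain, in which an idle state has
a single exit, to the busy state of the same level. -/
lemma hasDerivAt_ratio_idle (hp : IsForwardSolution lam mu theta m p)
    (h : IsStationary lam mu theta x) (k : ℕ) {t : ℝ} (ht : 0 < t) :
    HasDerivAt (fun t => p (idle, k) t / x (idle, k))
      ((lam + k * theta) * (p (busy, k) t / x (busy, k) - p (idle, k) t / x (idle, k))) t := by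
  refine ((hp.hasDerivAt_idle k t ht).div_const (x (idle, k))).congr_deriv ?_
  have h1 := h.pos (busy, k)
  have h2 := h.pos (idle, k)
  have h3 := h.balance k
  field_simp
  linear_combination p (busy, k) t * h3

/-- The reversed chain leaves `(busy, k)` for `(busy, k - 1)`, `(idle, k)` or `(idle, k + 1)`. For
`k = 0` the first rate is zero, so the truncated subtraction is harmless. -/
lemma hasDerivAt_ratio_busy (hp : IsForwardSolution lam mu theta m p)
    (h : IsStationary lam mu theta x) (k : ℕ) {t : ℝ} (ht : 0 < t) :
    HasDerivAt (fun t => p (busy, k) t / x (busy, k))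
      ((k * theta * x (idle, k) * (p (busy, k - 1) t / x (busy, k - 1) - p (busy, k) t / x (busy, k))
        + lam * x (idle, k) * (p (idle, k) t / x (idle, k) - p (busy, k) t / x (busy, k))) /
          x (busy, k)
        + lam * (p (idle, k + 1) t / x (idle, k + 1) - p (busy, k) t / x (busy, k))) t := by
  refine ((hp.hasDerivAt_busy k t ht).div_const (x (busy, k))).congr_deriv ?_
  have h1 := h.pos (busy, k)
  have h2 := h.pos (idle, k)
  have h3 := h.balance k
  have h4 := h.pos (idle, k + 1)
  have h5 := h.cut k
  have e1 : lam * (p (idle, k + 1) t / x (idle, k + 1)) * x (busy, k)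
      = ((k : ℝ) + 1) * theta * p (idle, k + 1) t := by
    field_simp
    linear_combination (-p (idle, k + 1) t) * h5
  have e2 : k * theta * x (idle, k) * (p (busy, k - 1) t / x (busy, k - 1))
      = if k = 0 then 0 else lam * p (busy, k - 1) t := by
    cases k with
    | zero => simp
    | succ k =>
      have h6 := h.cut k
      have h7 := h.pos (busy, k)
      simp only [Nat.add_sub_cancel, if_neg (Nat.succ_ne_zero k)]
      push_cast
      rw [h6]
      field_simp
  have e3 : lam * x (idle, k) * (p (idle, k) t / x (idle, k)) = lam * p (idle, k) t := by
    field_simp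
  have e4 : (mu * x (busy, k)) * (p (busy, k) t / x (busy, k)) = mu * p (busy, k) t := by
    field_simp
  have e5 : (lam * x (busy, k)) * (p (busy, k) t / x (busy, k)) = lam * p (busy, k) t := by
    field_simp
  rw [div_eq_iff h1.ne', add_mul (_ / _), div_mul_cancel₀ _ h1.ne', ← e2, ← e3, ← e1, add_mul lam mu, ← e4,
    ← e5]
  linear_combination (-(p (busy, k) t / x (busy, k))) * h3

/-- The energy inequality for a convex function `φ` of the density with respect to the
stationary distribution. -/
lemma energy_le (hp : IsForwardSolution lam mu theta m p) (h : IsStationary lam mu theta x)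
    (hlam : 0 < lam) (hmu : 0 < mu) (htheta : 0 < theta) {φ φ' : ℝ → ℝ} {κ : ℝ}
    (hκ : 0 ≤ κ)     (hφ : ∀ y, HasDerivAt φ (φ' y) y) (hφ0 : ∀ y, 0 ≤ φ y)
    (hconv : ∀ y z, φ' y * (z - y) ≤ φ z - φ y - κ * (z - y) ^ 2) (n : ℕ) {t : ℝ} (ht : 0 ≤ t) :
    energy x p φ n t + κ * ∫ s in (0 : ℝ)..t, dissipation lam mu x p n s ≤ energy x p φ n 0
      + ∫ s in (0 : ℝ)..t, lam * x (busy, n) * φ (p (idle, n + 1) s / x (idle, n + 1)) := by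
  have hφc : Continuous φ := continuous_iff_continuousAt.2 fun y => (hφ y).continuousAt
  have hpc := hp.continuous
  have hEc : Continuous (energy x p φ n) := by unfold energy; fun_prop
  have hDc : Continuous (dissipation lam mu x p n) := by unfold dissipation; fun_prop
  have hFc : Continuous fun s => lam * x (busy, n) * φ (p (idle, n + 1) s / x (idle, n + 1)) := by
    fun_prop
  set g : ℝ → ℝ := fun t => (∫ s in (0 : ℝ)..t, lam * x (busy, n) *
    φ (p (idle, n + 1) s / x (idle, n + 1))) - κ * (∫ s in (0 : ℝ)..t, dissipation lam mu x p n s)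
    - energy x p φ n t with hg
  have hIF : ∀ s, HasDerivAt (fun t => ∫ s in (0 : ℝ)..t, lam * x (busy, n) *
      φ (p (idle, n + 1) s / x (idle, n + 1))) (lam * x (busy, n) *
      φ (p (idle, n + 1) s / x (idle, n + 1))) s := fun s =>
    intervalIntegral.integral_hasDerivAt_right (hFc.intervalIntegrable _ _)
      hFc.aestronglyMeasurable.stronglyMeasurableAtFilter hFc.continuousAt
  have hID : ∀ s, HasDerivAt (fun t => ∫ s in (0 : ℝ)..t, dissipation lam mu x p n s)
      (dissipation lam mu x p n s) s := fun s =>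
    intervalIntegral.integral_hasDerivAt_right (hDc.intervalIntegrable _ _)
      hDc.aestronglyMeasurable.stronglyMeasurableAtFilter hDc.continuousAt
  have hE : ∀ s, 0 < s → ∃ e, HasDerivAt (energy x p φ n) e s ∧
      e ≤ lam * x (busy, n) * φ (p (idle, n + 1) s / x (idle, n + 1))
        - κ * dissipation lam mu x p n s := by
    intro s hs
    refine ⟨_, HasDerivAt.fun_sum fun k _ =>
      (((hφ _).comp s (hp.hasDerivAt_ratio_busy h k hs)).const_mul (x (busy, k))).add
      (((hφ _).comp s (hp.hasDerivAt_ratio_idle h k hs)).const_mul (x (idle, k))), ?_⟩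
    set r : State → ℝ := fun s' => p s' s / x s' with hr
    -- `bd k` is the part of the energy balance exchanged between the levels `k - 1` and `k`; it
    -- telescopes.
    set bd : ℕ → ℝ := fun k =>
      k * theta * x (idle, k) * (φ (r (busy, k - 1)) - φ (r (idle, k))) with hbd
    have hlevel : ∀ k, x (busy, k) * (φ' (r (busy, k)) *
        ((k * theta * x (idle, k) * (r (busy, k - 1) - r (busy, k))
        + lam * x (idle, k) * (r (idle, k) - r (busy, k))) / x (busy, k)
        + lam * (r (idle, k + 1) - r (busy, k)))) + x (idle, k) * (φ' (r (idle, k)) *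
        ((lam + k * theta) * (r (busy, k) - r (idle, k)))) ≤ (bd k - bd (k + 1))
        - κ * (mu * x (busy, k) * (r (busy, k) - r (idle, k)) ^ 2
          + lam * x (busy, k) * (r (idle, k + 1) - r (busy, k)) ^ 2) := by
      intro k
      have h1 := h.pos (busy, k)
      have h2 := h.pos (idle, k)
      have h3 := h.balance k
      have h5 := h.cut k
      have hk : (0 : ℝ) ≤ k * theta * x (idle, k) := by positivity
      have c1 := mul_le_mul_of_nonneg_left (hconv (r (busy, k)) (r (busy, k - 1))) hk
      have c2 := mul_le_mul_of_nonneg_left (hconv (r (busy, k)) (r (idle, k)))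
        (mul_pos hlam h2).le
      have c3 := mul_le_mul_of_nonneg_left (hconv (r (busy, k)) (r (idle, k + 1)))
        (mul_pos hlam h1).le
      have c4 := mul_le_mul_of_nonneg_left (hconv (r (idle, k)) (r (busy, k)))
        (mul_pos hmu h1).le
      -- The dissipation along these two kinds of transition is discarded: the two kinds kept
      -- already connect all states.
      have d1 : 0 ≤ k * theta * x (idle, k) * (κ * (r (busy, k - 1) - r (busy, k)) ^ 2) := by
        positivity
      have d2 : 0 ≤ lam * x (idle, k) * (κ * (r (idle, k) - r (busy, k)) ^ 2) := by positivity
      have e1 : x (busy, k) * (φ' (r (busy, k)) *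
          ((k * theta * x (idle, k) * (r (busy, k - 1) - r (busy, k))
          + lam * x (idle, k) * (r (idle, k) - r (busy, k))) / x (busy, k)
          + lam * (r (idle, k + 1) - r (busy, k)))) =
          k * theta * x (idle, k) * (φ' (r (busy, k)) * (r (busy, k - 1) - r (busy, k)))
          + lam * x (idle, k) * (φ' (r (busy, k)) * (r (idle, k) - r (busy, k)))
          + lam * x (busy, k) * (φ' (r (busy, k)) * (r (idle, k + 1) - r (busy, k))) := by
        field_simp
      have e2 : x (idle, k) * (φ' (r (idle, k)) *
          ((lam + k * theta) * (r (busy, k) - r (idle, k))))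
          = mu * x (busy, k) * (φ' (r (idle, k)) * (r (busy, k) - r (idle, k))) := by
        rw [h3]
        ring
      have e3 : bd (k + 1) = lam * x (busy, k) * (φ (r (busy, k)) - φ (r (idle, k + 1))) := by
        simp only [hbd, Nat.add_sub_cancel]
        rw [← h5]
        push_cast
        ring
      have e4 : mu * x (busy, k) * (φ (r (busy, k)) - φ (r (idle, k)))
          = (lam + k * theta) * x (idle, k) * (φ (r (busy, k)) - φ (r (idle, k))) := by rw [h3]
      rw [e1, e2, e3]
      simp only [hbd]
      linarith
    refine (Finset.sum_le_sum fun k _ => hlevel k).trans ?_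
    rw [Finset.sum_sub_distrib, Finset.sum_range_sub', ← Finset.mul_sum]
    have hb : bd (n + 1)
        = lam * x (busy, n) * (φ (r (busy, n)) - φ (r (idle, n + 1))) := by
      simp only [hbd, Nat.add_sub_cancel]
      rw [← h.cut n]
      push_cast
      ring
    have hb0 : bd 0 = 0 := by simp [hbd]
    -- As `φ ≥ 0`, the negative part of the flux through the top level can be dropped.
    have hpos := mul_nonneg (mul_pos hlam (h.pos (busy, n))).le (hφ0 (r (busy, n)))
    rw [hb, hb0, dissipation]
    linarith
  have hmono : MonotoneOn g (Set.Ici 0) := by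
    have hgd : ∀ s, 0 < s → ∃ e, HasDerivAt g e s ∧ 0 ≤ e := fun s hs => by
      obtain ⟨e, he, hle⟩ := hE s hs
      exact ⟨_, ((hIF s).sub ((hID s).const_mul κ)).sub he, by linarith⟩
    refine monotoneOn_of_deriv_nonneg (convex_Ici 0) ?_ ?_ ?_
    · refine Continuous.continuousOn ?_
      refine Continuous.sub (Continuous.sub ?_ (Continuous.mul continuous_const ?_)) hEc
      · exact continuous_iff_continuousAt.2 fun s => (hIF s).continuousAt
      · exact continuous_iff_continuousAt.2 fun s => (hID s).continuousAt
    · intro s hs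
      rw [interior_Ici] at hs
      obtain ⟨e, he, -⟩ := hgd s hs
      exact he.differentiableAt.differentiableWithinAt
    · intro s hs
      rw [interior_Ici] at hs
      obtain ⟨e, he, h0⟩ := hgd s hs
      rwa [he.deriv]
  have := hmono Set.self_mem_Ici (Set.mem_Ici.2 ht) ht
  simp only [hg, intervalIntegral.integral_same, mul_zero] at this
  linarith

end IsForwardSolution

/-! ### Comparison with the stationary law and convergence. -/

namespace IsForwardSolution

variable {lam mu theta m : ℝ} {x : State → ℝ} {p : State → ℝ → ℝ}

/-- At each time the idle masses sum to at most `m`. This is what makes the flux through suitable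
truncation levels small. -/
lemma summable_integral_idle (hp : IsForwardSolution lam mu theta m p) {t : ℝ} (ht : 0 ≤ t) :
    Summable fun n : ℕ => ∫ s in (0 : ℝ)..t, p (idle, n) s := by
  have hint : ∀ n, IntervalIntegrable (p (idle, n)) volume 0 t := fun n =>
    (hp.continuous _).intervalIntegrable _ _
  refine summable_of_sum_range_le (c := ∫ _ in (0 : ℝ)..t, m)
    (fun n => intervalIntegral.integral_nonneg ht fun s _ => hp.nonneg _ _) fun N => ?_
  rw [← intervalIntegral.integral_finsetSum fun n _ => hint n]
  refine intervalIntegral.integral_mono_on ht ?_ intervalIntegrable_const fun s _ => ?_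
  · exact (continuous_finsetSum _ fun n _ => hp.continuous _).intervalIntegrable _ _
  · have hinj : Function.Injective fun n : ℕ => ((idle, n) : State) :=
      fun _ _ h => (Prod.ext_iff.1 h).2
    have := sum_le_hasSum ((Finset.range N).map ⟨_, hinj⟩) (fun _ _ => hp.nonneg _ _) (hp.hasSum s)
    rwa [Finset.sum_map] at this

/-- Comparison with the stationary distribution is preserved by the forward equations. -/
lemma le_mul (hp : IsForwardSolution lam mu theta m p) (h : IsStationary lam mu theta x)
    (hlam : 0 < lam) (hmu : 0 < mu) (htheta : 0 < theta) {c : ℝ} (hc : 0 ≤ c)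
    (h0 : ∀ s, p s 0 ≤ c * x s) (s : State) {t : ℝ} (ht : 0 ≤ t) : p s t ≤ c * x s := by
  by_contra! hcon
  have hxs := h.pos s
  have hε : 0 < x s * softPos c (p s t / x s) :=
    mul_pos hxs (softPos_pos ((lt_div_iff₀ hxs).2 hcon))
  -- The truncation level lies above `s` and makes the boundary flux smaller than the energy that a
  -- violation at `s` would create.
  obtain ⟨n, hn, hlt⟩ := exists_ge_mul_lt_of_summable
    ((hp.summable_integral_idle ht).mul_left theta) hε s.2
  have hE := hp.energy_le h hlam hmu htheta (φ := softPos c) (φ' := softPosDeriv c) (κ := 0) le_rfl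
    (hasDerivAt_softPos c) (softPos_nonneg c) (fun y z => by
      simpa using softPosDeriv_mul_le c y z) n ht
  have hE0 : energy x p (softPos c) n 0 = 0 := by
    refine Finset.sum_eq_zero fun k _ => ?_
    rw [softPos_eq_zero ((div_le_iff₀ (h.pos _)).2 (h0 _)),
      softPos_eq_zero ((div_le_iff₀ (h.pos _)).2 (h0 _))]
    simp
  have hEt : x s * softPos c (p s t / x s) ≤ energy x p (softPos c) n t := by
    have hterm : ∀ s', 0 ≤ x s' * softPos c (p s' t / x s') := fun s' =>
      mul_nonneg (h.pos _).le (softPos_nonneg _ _)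
    refine le_trans ?_ (Finset.single_le_sum (fun k _ => add_nonneg (hterm _) (hterm _))
      (Finset.mem_range.2 (Nat.lt_succ_of_le hn)))
    obtain ⟨a, k⟩ := s
    fin_cases a
    · exact le_add_of_nonneg_right (hterm _)
    · exact le_add_of_nonneg_left (hterm _)
  -- Linear growth of `softPos` and the cut equation reduce the boundary flux to the retrial rate
  -- out of level `n + 1`.
  have hb : ∫ s in (0 : ℝ)..t, lam * x (busy, n) * softPos c (p (idle, n + 1) s / x (idle, n + 1))
      ≤ ((n : ℝ) + 1) * (theta * ∫ s in (0 : ℝ)..t, p (idle, n + 1) s) := by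
    rw [← mul_assoc, ← intervalIntegral.integral_const_mul]
    have hsc : Continuous (softPos c) :=
      continuous_iff_continuousAt.2 fun y => (hasDerivAt_softPos c y).continuousAt
    have hpc := hp.continuous
    refine intervalIntegral.integral_mono_on ht ?_ ?_ fun r _ => ?_
    · exact Continuous.intervalIntegrable (by fun_prop) _ _
    · exact Continuous.intervalIntegrable (by fun_prop) _ _
    · have hx := h.pos (idle, n + 1)
      have h1 := softPos_le hc (div_nonneg (hp.nonneg (idle, n + 1) r) hx.le)
      rw [← h.cut n]
      calc _ ≤ ((n : ℝ) + 1) * theta * x (idle, n + 1) * (p (idle, n + 1) r / x (idle, n + 1)) := by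
            gcongr
        _ = _ := by field_simp
  rw [zero_mul, add_zero, hE0, zero_add] at hE
  linarith

/-- For the square, the initial energy is at most `c ^ 2`. The density being bounded, the boundary
flux carries the factor `x (busy, n)` and disappears as `n → ∞` with `t` fixed, so the bound is
uniform in time. -/
lemma integral_dissipation_le (hp : IsForwardSolution lam mu theta m p)
    (h : IsStationary lam mu theta x) (hlam : 0 < lam) (hmu : 0 < mu) (htheta : 0 < theta) {c : ℝ}
    (hc : 0 ≤ c) (h0 : ∀ s, p s 0 ≤ c * x s) (k : ℕ) {t : ℝ} (ht : 0 ≤ t) :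
    ∫ s in (0 : ℝ)..t, dissipation lam mu x p k s ≤ c ^ 2 := by
  have hpc := hp.continuous
  have hr : ∀ s {r}, 0 ≤ r → (p s r / x s) ^ 2 ≤ c ^ 2 := fun s r hr =>
    pow_le_pow_left₀ (div_nonneg (hp.nonneg _ _) (h.pos _).le)
      ((div_le_iff₀ (h.pos _)).2 (hp.le_mul h hlam hmu htheta hc h0 s hr)) 2
  have hDc : ∀ n, Continuous (dissipation lam mu x p n) := fun n => by
    unfold dissipation; fun_prop
  have key : ∀ n, k ≤ n → ∫ s in (0 : ℝ)..t, dissipation lam mu x p k s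
      ≤ c ^ 2 + lam * x (busy, n) * c ^ 2 * t := by
    intro n hn
    have hE := hp.energy_le h hlam hmu htheta (φ := fun y => y ^ 2) (φ' := fun y => 2 * y) (κ := 1)
      zero_le_one (fun y => by simpa using hasDerivAt_pow 2 y) (fun y => sq_nonneg y)
      (fun y z => by nlinarith) n ht
    have h1 : 0 ≤ energy x p (fun y => y ^ 2) n t := Finset.sum_nonneg fun k _ =>
      add_nonneg (mul_nonneg (h.pos _).le (sq_nonneg _)) (mul_nonneg (h.pos _).le (sq_nonneg _))
    have h2 : energy x p (fun y => y ^ 2) n 0 ≤ c ^ 2 := by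
      have hsum : ∑ k ∈ Finset.range (n + 1), (x (busy, k) + x (idle, k)) ≤ 1 := by
        have := sum_le_hasSum (Finset.univ ×ˢ Finset.range (n + 1)) (fun _ _ => (h.pos _).le)
          h.hasSum
        rwa [Finset.sum_product, Fin.sum_univ_two, ← Finset.sum_add_distrib] at this
      calc energy x p (fun y => y ^ 2) n 0
          ≤ ∑ k ∈ Finset.range (n + 1), (x (busy, k) + x (idle, k)) * c ^ 2 := by
            refine Finset.sum_le_sum fun k _ => ?_
            rw [add_mul]
            exact add_le_add (mul_le_mul_of_nonneg_left (hr _ le_rfl) (h.pos _).le)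
              (mul_le_mul_of_nonneg_left (hr _ le_rfl) (h.pos _).le)
        _ ≤ c ^ 2 := by
            rw [← Finset.sum_mul]
            exact mul_le_of_le_one_left (sq_nonneg c) hsum
    have h3 : ∫ s in (0 : ℝ)..t, lam * x (busy, n) * (p (idle, n + 1) s / x (idle, n + 1)) ^ 2
        ≤ lam * x (busy, n) * c ^ 2 * t := by
      have hx := h.pos (busy, n)
      calc _ ≤ ∫ s in (0 : ℝ)..t, lam * x (busy, n) * c ^ 2 := by
            refine intervalIntegral.integral_mono_on ht
              (Continuous.intervalIntegrable (by fun_prop) _ _) intervalIntegrable_const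
              fun r hr' => ?_
            exact mul_le_mul_of_nonneg_left (hr _ hr'.1) (by positivity)
        _ = _ := by
            rw [intervalIntegral.integral_const, smul_eq_mul]
            ring
    have h4 : ∫ s in (0 : ℝ)..t, dissipation lam mu x p k s
        ≤ ∫ s in (0 : ℝ)..t, dissipation lam mu x p n s := by
      refine intervalIntegral.integral_mono_on ht ((hDc k).intervalIntegrable _ _)
        ((hDc n).intervalIntegrable _ _) fun r _ => ?_
      refine Finset.sum_le_sum_of_subset_of_nonneg (Finset.range_mono (by omega)) fun j _ _ => ?_
      have := h.pos (busy, j)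
      positivity
    linarith
  have hlim : Tendsto (fun n => c ^ 2 + lam * x (busy, n) * c ^ 2 * t) atTop (𝓝 (c ^ 2)) := by
    have := (((((h.summable busy).tendsto_atTop_zero).const_mul lam).mul_const (c ^ 2)).mul_const
      t).const_add (c ^ 2)
    simpa using this
  exact ge_of_tendsto hlim ((eventually_ge_atTop k).mono key)

lemma abs_sub_le_of_mem {a b c : ℝ} (ha : 0 ≤ a) (hb : 0 ≤ b) (hac : a ≤ c) (hbc : b ≤ c) :
    |a - b| ≤ c := abs_le.2 ⟨by linarith, by linarith⟩

lemma exists_hasDerivAt_ratio_le (hp : IsForwardSolution lam mu theta m p)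
    (h : IsStationary lam mu theta x) (hlam : 0 < lam) (htheta : 0 < theta) {c : ℝ}
    (hr : ∀ s t, 0 < t → p s t / x s ≤ c) (s : State) :
    ∃ (r' : ℝ → ℝ) (L : ℝ), ∀ t, 0 < t →
      HasDerivAt (fun t => p s t / x s) (r' t) t ∧ |r' t| ≤ L := by
  have hd : ∀ s s' t, 0 < t → |p s t / x s - p s' t / x s'| ≤ c := fun s s' t ht =>
    abs_sub_le_of_mem (div_nonneg (hp.nonneg _ _) (h.pos _).le)
      (div_nonneg (hp.nonneg _ _) (h.pos _).le) (hr _ _ ht) (hr _ _ ht)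
  obtain ⟨a, k⟩ := s
  have h1 := h.pos (busy, k)
  have h2 := h.pos (idle, k)
  fin_cases a
  · refine ⟨_, (k * theta * x (idle, k) * c + lam * x (idle, k) * c) / x (busy, k) + lam * c,
      fun t ht => ⟨hp.hasDerivAt_ratio_busy h k ht, ?_⟩⟩
    refine (abs_add_le _ _).trans (add_le_add ?_ ?_)
    · rw [abs_div, abs_of_pos h1]
      refine div_le_div_of_nonneg_right ((abs_add_le _ _).trans (add_le_add ?_ ?_)) h1.le
      · rw [abs_mul, abs_of_nonneg (by positivity)]
        exact mul_le_mul_of_nonneg_left (hd _ _ t ht) (by positivity)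
      · rw [abs_mul, abs_of_nonneg (by positivity)]
        exact mul_le_mul_of_nonneg_left (hd _ _ t ht) (by positivity)
    · rw [abs_mul, abs_of_nonneg hlam.le]
      exact mul_le_mul_of_nonneg_left (hd _ _ t ht) hlam.le
  · refine ⟨_, (lam + k * theta) * c, fun t ht => ⟨hp.hasDerivAt_ratio_idle h k ht, ?_⟩⟩
    rw [abs_mul, abs_of_nonneg (by positivity)]
    exact mul_le_mul_of_nonneg_left (hd _ _ t ht) (by positivity)

/-- Differences of the density along the transitions tend to zero. -/
lemma tendsto_ratio_sub (hp : IsForwardSolution lam mu theta m p)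
    (h : IsStationary lam mu theta x) (hlam : 0 < lam) (hmu : 0 < mu) (htheta : 0 < theta) {c : ℝ}
    (hc : 0 ≤ c) (h0 : ∀ s, p s 0 ≤ c * x s) (k : ℕ) :
    Tendsto (fun t => p (busy, k) t / x (busy, k) - p (idle, k) t / x (idle, k)) atTop (𝓝 0) ∧
    Tendsto (fun t => p (idle, k + 1) t / x (idle, k + 1) - p (busy, k) t / x (busy, k)) atTop
      (𝓝 0) := by
  have hpc := hp.continuous
  have hr : ∀ s t, 0 < t → p s t / x s ≤ c := fun s t ht =>
    (div_le_iff₀ (h.pos _)).2 (hp.le_mul h hlam hmu htheta hc h0 s ht.le)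
  have hx := h.pos (busy, k)
  have key : ∀ (s s' : State) (a : ℝ), 0 < a →
      (∀ t, a * (p s t / x s - p s' t / x s') ^ 2 ≤ dissipation lam mu x p k t) →
      Tendsto (fun t => p s t / x s - p s' t / x s') atTop (𝓝 0) := by
    intro s s' a ha hle
    obtain ⟨r₁, L₁, h₁⟩ := hp.exists_hasDerivAt_ratio_le h hlam htheta hr s
    obtain ⟨r₂, L₂, h₂⟩ := hp.exists_hasDerivAt_ratio_le h hlam htheta hr s'
    refine tendsto_zero_of_integral_sq_le (B := c) (L := L₁ + L₂) (K := c ^ 2 / a) (by fun_prop)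
      (fun t ht => (h₁ t ht).1.sub (h₂ t ht).1) (fun t ht =>
        abs_sub_le_of_mem (div_nonneg (hp.nonneg _ _) (h.pos _).le)
          (div_nonneg (hp.nonneg _ _) (h.pos _).le) (hr _ _ ht) (hr _ _ ht))
      (fun t ht => (abs_sub _ _).trans (add_le_add (h₁ t ht).2 (h₂ t ht).2)) fun t ht => ?_
    rw [le_div_iff₀' ha, ← intervalIntegral.integral_const_mul]
    refine (intervalIntegral.integral_mono_on ht (Continuous.intervalIntegrable (by fun_prop) _ _)
      (Continuous.intervalIntegrable (by unfold dissipation; fun_prop) _ _)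
      fun r _ => hle r).trans (hp.integral_dissipation_le h hlam hmu htheta hc h0 k ht)
  have hterm : ∀ t,
      mu * x (busy, k) * (p (busy, k) t / x (busy, k) - p (idle, k) t / x (idle, k)) ^ 2
      + lam * x (busy, k) * (p (idle, k + 1) t / x (idle, k + 1) - p (busy, k) t / x (busy, k)) ^ 2
      ≤ dissipation lam mu x p k t := fun t =>
    Finset.single_le_sum (f := fun k =>
      mu * x (busy, k) * (p (busy, k) t / x (busy, k) - p (idle, k) t / x (idle, k)) ^ 2
      + lam * x (busy, k) *
        (p (idle, k + 1) t / x (idle, k + 1) - p (busy, k) t / x (busy, k)) ^ 2)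
      (fun j _ => by have := h.pos (busy, j); positivity) (Finset.self_mem_range_succ k)
  exact ⟨key _ _ _ (mul_pos hmu hx) fun t =>
      le_trans (le_add_of_nonneg_right (by positivity)) (hterm t),
    key _ _ _ (mul_pos hlam hx) fun t => le_trans (le_add_of_nonneg_left (by positivity)) (hterm t)⟩

/-- The path `(idle, 0)`, `(busy, 0)`, `(idle, 1)`, … links all states, so every density has the
same asymptotics as that of `(idle, 0)`. Averaging against `x`, by dominated convergence, shows that
this common value tends to `m`. -/
lemma tendsto_stationary (hp : IsForwardSolution lam mu theta m p)
    (h : IsStationary lam mu theta x) (hlam : 0 < lam) (hmu : 0 < mu) (htheta : 0 < theta) {c : ℝ}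
    (hc : 0 ≤ c) (h0 : ∀ s, p s 0 ≤ c * x s) (s : State) :
    Tendsto (p s) atTop (𝓝 (m * x s)) := by
  set r : State → ℝ → ℝ := fun s t => p s t / x s with hr
  have hr0 : ∀ s t, 0 ≤ r s t := fun s t => div_nonneg (hp.nonneg _ _) (h.pos _).le
  have hrc : ∀ s {t}, 0 ≤ t → r s t ≤ c := fun s t ht =>
    (div_le_iff₀ (h.pos _)).2 (hp.le_mul h hlam hmu htheta hc h0 s ht)
  have hdiff : ∀ k, Tendsto (fun t => r (idle, k) t - r (idle, 0) t) atTop (𝓝 0) ∧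
      Tendsto (fun t => r (busy, k) t - r (idle, 0) t) atTop (𝓝 0) := by
    have key : ∀ k, Tendsto (fun t => r (idle, k) t - r (idle, 0) t) atTop (𝓝 0) →
        Tendsto (fun t => r (busy, k) t - r (idle, 0) t) atTop (𝓝 0) := fun k hk => by
      have h1 := (hp.tendsto_ratio_sub h hlam hmu htheta hc h0 k).1.add hk
      rw [add_zero] at h1
      exact h1.congr fun t => sub_add_sub_cancel _ _ _
    intro k
    induction k with
    | zero => exact ⟨by simp, key 0 (by simp)⟩
    | succ k ih =>
      have h1 : Tendsto (fun t => r (idle, k + 1) t - r (idle, 0) t) atTop (𝓝 0) := by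
        have h2 := (hp.tendsto_ratio_sub h hlam hmu htheta hc h0 k).2.add ih.2
        rw [add_zero] at h2
        exact h2.congr fun t => sub_add_sub_cancel _ _ _
      exact ⟨h1, key _ h1⟩
  have hdiff' : ∀ s, Tendsto (fun t => r s t - r (idle, 0) t) atTop (𝓝 0) := by
    rintro ⟨a, k⟩
    fin_cases a
    · exact (hdiff k).2
    · exact (hdiff k).1
  have hsum : Tendsto (fun t => ∑' s, x s * (r s t - r (idle, 0) t)) atTop (𝓝 (∑' _ : State, 0)) := by
    refine tendsto_tsum_of_dominated_convergence (bound := fun s => x s * c)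
      (h.hasSum.summable.mul_right c) (fun s => by simpa using (hdiff' s).const_mul (x s)) ?_
    filter_upwards [eventually_ge_atTop 0] with t ht s
    rw [norm_mul, Real.norm_of_nonneg (h.pos s).le]
    exact mul_le_mul_of_nonneg_left (abs_sub_le_of_mem (hr0 _ _) (hr0 _ _) (hrc _ ht) (hrc _ ht))
      (h.pos s).le
  have heq : ∀ t, ∑' s, x s * (r s t - r (idle, 0) t) = m - r (idle, 0) t := fun t => by
    have h1 := (hp.hasSum t).sub (h.hasSum.mul_right (r (idle, 0) t))
    rw [one_mul] at h1
    rw [← h1.tsum_eq]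
    refine tsum_congr fun s => ?_
    have := h.pos s
    simp only [hr]
    field_simp
  simp only [heq, tsum_zero] at hsum
  have hlim : Tendsto (fun t => x s * r s t) atTop (𝓝 (x s * m)) := by
    have h1 := ((hdiff' s).sub hsum).add_const m
    simp only [sub_zero, zero_add] at h1
    refine (h1.congr fun t => ?_).const_mul (x s)
    ring
  rw [mul_comm]
  refine hlim.congr fun t => ?_
  exact mul_div_cancel₀ _ (h.pos s).ne'

end IsForwardSolution

/-! ### From the martingale problem to the forward equations. -/

/-- Approximation of a time from the right. -/
lemma tendsto_floor_add_one_div (t : ℝ≥0) :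
    Tendsto (fun n : ℕ => ((⌊((n : ℝ≥0) + 1) * t⌋₊ : ℝ≥0) + 1) / ((n : ℝ≥0) + 1))
      atTop (𝓝[Set.Ici t] t) := by
  have hle : ∀ n : ℕ, t ≤ ((⌊((n : ℝ≥0) + 1) * t⌋₊ : ℝ≥0) + 1) / ((n : ℝ≥0) + 1) := fun n => by
    rw [le_div_iff₀ (by positivity), mul_comm]
    exact (Nat.lt_floor_add_one _).le
  have hge : ∀ n : ℕ, ((⌊((n : ℝ≥0) + 1) * t⌋₊ : ℝ≥0) + 1) / ((n : ℝ≥0) + 1)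
      ≤ t + 1 / ((n : ℝ≥0) + 1) := fun n => by
    rw [add_div]
    gcongr
    rw [div_le_iff₀ (by positivity), mul_comm t]
    exact Nat.floor_le zero_le
  have h1 : Tendsto (fun n : ℕ => t + 1 / ((n : ℝ≥0) + 1)) atTop (𝓝 t) := by
    have h2 : Tendsto (fun n : ℕ => 1 / ((n : ℝ≥0) + 1)) atTop (𝓝 0) :=
      tendsto_one_div_add_atTop_nhds_zero_nat
    simpa using h2.const_add t
  exact tendsto_nhdsWithin_iff.2
    ⟨tendsto_of_tendsto_of_tendsto_of_le_of_le tendsto_const_nhds h1 hle hge, .of_forall hle⟩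

/-- Right-continuity makes the process a limit of versions sampled on countable grids. The joint
measurability is needed for Fubini in Dynkin's formula. -/
lemma measurable_uncurry_of_approx {Ω : Type*} {mΩ : MeasurableSpace Ω}
    {X : ℝ≥0 → Ω → State} (hm : ∀ t, Measurable (X t))
    (hc : ∀ ω t, ContinuousWithinAt (fun s => X s ω) (Set.Ici t) t)
    {d : ℕ → ℕ → ℝ≥0} {κ : ℕ → ℝ≥0 → ℕ} (hκ : ∀ n, Measurable (κ n))
    (hlim : ∀ t, Tendsto (fun n => d n (κ n t)) atTop (𝓝[Set.Ici t] t)) :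
    Measurable (Function.uncurry X) := by
  have h1 : ∀ n, Measurable fun q : ℕ × Ω => X (d n q.1) q.2 := fun n =>
    measurable_from_prod_countable_right fun k => hm (d n k)
  have h2 : ∀ n, Measurable fun q : ℝ≥0 × Ω => X (d n (κ n q.1)) q.2 := fun n =>
    (h1 n).comp (((hκ n).comp measurable_fst).prodMk measurable_snd)
  exact measurable_of_tendsto_metrizable h2
    (tendsto_pi_nhds.2 fun q => (hc q.2 q.1).tendsto.comp (hlim q.1))

lemma measurable_uncurry_of_rightContinuous {Ω : Type*} {mΩ : MeasurableSpace Ω}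
    {X : ℝ≥0 → Ω → State} (hm : ∀ t, Measurable (X t))
    (hc : ∀ ω t, ContinuousWithinAt (fun s => X s ω) (Set.Ici t) t) :
    Measurable (Function.uncurry X) :=
  measurable_uncurry_of_approx hm hc
    (d := fun n k => ((k : ℝ≥0) + 1) / ((n : ℝ≥0) + 1)) (κ := fun n t => ⌊((n : ℝ≥0) + 1) * t⌋₊)
    (fun _ => Nat.measurable_floor.comp (measurable_id.const_mul _)) tendsto_floor_add_one_div

lemma hasSum_measureReal_fiber {Ω : Type*} {mΩ : MeasurableSpace Ω} (ν : Measure Ω)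
    [IsFiniteMeasure ν] {Y : Ω → State} (hY : Measurable Y) :
    HasSum (fun s => ν.real {ω | Y ω = s}) (ν.real Set.univ) := by
  have h1 : ∑' s, ν (Y ⁻¹' {s}) = ν Set.univ := by
    have h2 := tsum_measure_preimage_singleton (μ := ν) (Set.countable_univ (α := State)) (f := Y)
      fun s _ => hY (measurableSet_singleton s)
    rw [tsum_univ (fun s => ν (Y ⁻¹' {s}))] at h2
    simpa using h2
  have h3 := ENNReal.hasSum_toReal (f := fun s => ν (Y ⁻¹' {s})) (by rw [h1]; exact measure_ne_top _ _)
  rwa [← ENNReal.tsum_toReal_eq (fun s => measure_ne_top _ _), h1] at h3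

/-- This is a row of the adjoint generator: the coefficients are those of the forward equation at
`(busy, k)`. At `k = 0` the state `(busy, k - 1)` has coefficient zero. -/
lemma generator_single_busy (lam mu theta : ℝ) (k : ℕ) (s : State) :
    generator lam mu theta (Pi.single (busy, k) 1) s =
      ∑ i : Fin 4, (![if k = 0 then 0 else lam, -(lam + mu), lam, ((k : ℝ) + 1) * theta] : Fin 4 → ℝ) i
        * (Pi.single ((![(busy, k - 1), (busy, k), (idle, k), (idle, k + 1)] : Fin 4 → State) i) 1 :
          State → ℝ) s := by
  obtain ⟨c, j⟩ := s
  simp only [Fin.sum_univ_four, generator, Pi.single_apply, Prod.mk.injEq]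
  fin_cases c
  · simp
    split_ifs <;> first | (exfalso; omega) | (subst_vars; ring)
  · cases j
    · simp
    · simp
      split_ifs <;> subst_vars <;> ring

lemma generator_single_idle (lam mu theta : ℝ) (k : ℕ) (s : State) :
    generator lam mu theta (Pi.single (idle, k) 1) s =
      ∑ i : Fin 2, (![mu, -(lam + k * theta)] : Fin 2 → ℝ) i
        * (Pi.single ((![(busy, k), (idle, k)] : Fin 2 → State) i) 1 : State → ℝ) s := by
  obtain ⟨c, j⟩ := s
  simp only [Fin.sum_univ_two, generator, Pi.single_apply, Prod.mk.injEq]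
  fin_cases c
  · simp
  · simp
    split_ifs <;> subst_vars <;> ring

namespace IsRetrialQueue

variable {Ω : Type*} {mΩ : MeasurableSpace Ω} {lam mu theta : ℝ} {P : Measure Ω}
  {ℱ : Filtration ℝ≥0 mΩ} {X : ℝ≥0 → Ω → State}

lemma measurable (hX : IsRetrialQueue lam mu theta P ℱ X) (t : ℝ≥0) : Measurable (X t) :=
  (hX.adapted t).mono (ℱ.le t) le_rfl

lemma measurable_uncurry_real (hX : IsRetrialQueue lam mu theta P ℱ X) :
    Measurable fun q : ℝ × Ω => X q.1.toNNReal q.2 :=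
  (measurable_uncurry_of_rightContinuous hX.measurable hX.rightContinuous).comp
    ((measurable_real_toNNReal.comp measurable_fst).prodMk measurable_snd)

lemma measurableSet_fiber (hX : IsRetrialQueue lam mu theta P ℱ X) (t : ℝ≥0) (s : State) :
    MeasurableSet {ω | X t ω = s} :=
  hX.measurable t (measurableSet_singleton s)

/-- Dynkin's formula on an initial event. -/
lemma setIntegral_eq [IsProbabilityMeasure P] (hX : IsRetrialQueue lam mu theta P ℱ X)
    {f : State → ℝ} (hf : (Function.support f).Finite) {C C' : ℝ} (hC : ∀ s, ‖f s‖ ≤ C)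
    (hC' : ∀ s, ‖generator lam mu theta f s‖ ≤ C') {A : Set Ω} (hA : MeasurableSet[ℱ 0] A)
    {t : ℝ} (ht : 0 ≤ t) :
    ∫ ω in A, f (X t.toNNReal ω) ∂P = ∫ ω in A, f (X 0 ω) ∂P
      + ∫ s in (0 : ℝ)..t, ∫ ω in A, generator lam mu theta f (X s.toNNReal ω) ∂P := by
  have h1 := (hX.martingale f hf).setIntegral_eq (zero_le (a := t.toNNReal)) hA
  have hfi : ∀ t, Integrable (fun ω => f (X t ω)) (P.restrict A) := fun t =>
    Integrable.of_bound ((measurable_of_countable f).comp (hX.measurable t)).aestronglyMeasurable C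
      (.of_forall fun ω => hC _)
  have hfin : IsFiniteMeasure (volume.restrict (Set.uIoc 0 t)) := ⟨by simp [Set.uIoc_of_le ht]⟩
  have hG : Integrable (Function.uncurry fun (s : ℝ) ω => generator lam mu theta f (X s.toNNReal ω))
      ((volume.restrict (Set.uIoc 0 t)).prod (P.restrict A)) :=
    Integrable.of_bound ((measurable_of_countable (generator lam mu theta f)).comp
      hX.measurable_uncurry_real).aestronglyMeasurable C' (.of_forall fun q => hC' _)
  rw [intervalIntegral_integral_swap hG]
  simp only [NNReal.coe_zero, intervalIntegral.integral_same, sub_zero, Real.coe_toNNReal t ht] at h1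
  have hGi : Integrable (fun ω => ∫ s in (0 : ℝ)..t, generator lam mu theta f (X s.toNNReal ω))
      (P.restrict A) := by
    simp only [intervalIntegral.integral_of_le ht]
    rw [Set.uIoc_of_le ht] at hG
    exact hG.integral_prod_right
  rw [integral_sub (hfi _) hGi] at h1
  linarith

/-- The probability that the chain starts in `s₀` and is in `s` at time `t`. -/
noncomputable def _root_.RetrialQueue.jointProb (P : Measure Ω) (X : ℝ≥0 → Ω → State)
    (s₀ s : State) (t : ℝ) : ℝ :=
  (P.restrict {ω | X 0 ω = s₀}).real {ω | X t.toNNReal ω = s}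

lemma setIntegral_single [IsProbabilityMeasure P] (hX : IsRetrialQueue lam mu theta P ℱ X)
    (s₀ s : State) (t : ℝ) :
    ∫ ω in {ω | X 0 ω = s₀}, (Pi.single s 1 : State → ℝ) (X t.toNNReal ω) ∂P
      = jointProb P X s₀ s t := by
  rw [jointProb, ← integral_indicator_one (hX.measurableSet_fiber _ s)]
  refine integral_congr_ae (.of_forall fun ω => ?_)
  simp [Pi.single_apply, Set.indicator_apply]

lemma jointProb_forward [IsProbabilityMeasure P] (hX : IsRetrialQueue lam mu theta P ℱ X)
    (s₀ s : State) {n : ℕ} {a : Fin n → ℝ} {r : Fin n → State}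
    (hgen : ∀ s', generator lam mu theta (Pi.single s 1) s'
      = ∑ i, a i * (Pi.single (r i) 1 : State → ℝ) s') {t : ℝ} (ht : 0 ≤ t) :
    jointProb P X s₀ s t = jointProb P X s₀ s 0
      + ∫ τ in (0 : ℝ)..t, ∑ i, a i * jointProb P X s₀ (r i) τ := by
  have hb : ∀ s s' : State, ‖(Pi.single s 1 : State → ℝ) s'‖ ≤ 1 := fun s s' => by
    rw [Pi.single_apply]; split_ifs <;> simp
  have h1 := hX.setIntegral_eq (f := Pi.single s 1) (C := 1) (C' := ∑ i, |a i|)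
    ((Set.finite_singleton s).subset Pi.support_single_subset) (hb s) (fun s' => by
      rw [hgen]
      refine (norm_sum_le _ _).trans (Finset.sum_le_sum fun i _ => ?_)
      rw [norm_mul]
      exact mul_le_of_le_one_right (norm_nonneg _) (hb _ _))
    (A := {ω | X 0 ω = s₀}) (hX.adapted 0 (measurableSet_singleton s₀)) ht
  have h0 := hX.setIntegral_single s₀ s 0
  rw [Real.toNNReal_zero] at h0
  rw [hX.setIntegral_single, h0] at h1
  rw [h1]
  congr 1
  refine intervalIntegral.integral_congr fun τ _ => ?_
  simp only [hgen]
  rw [integral_finsetSum]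
  · refine Finset.sum_congr rfl fun i _ => ?_
    rw [integral_const_mul, hX.setIntegral_single]
  · intro i _
    refine Integrable.const_mul ?_ _
    exact Integrable.of_bound ((measurable_of_countable _).comp
      (hX.measurable _)).aestronglyMeasurable 1 (.of_forall fun ω => hb _ _)

lemma jointProb_nonneg (s₀ s : State) (t : ℝ) : 0 ≤ jointProb P X s₀ s t := measureReal_nonneg

lemma jointProb_le_one [IsProbabilityMeasure P] (s₀ s : State) (t : ℝ) :
    jointProb P X s₀ s t ≤ 1 := by
  rw [jointProb, measureReal_def]
  refine ENNReal.toReal_le_of_le_ofReal zero_le_one ?_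
  rw [ENNReal.ofReal_one]
  exact (Measure.restrict_apply_le _ _).trans prob_le_one

lemma measurable_jointProb [IsProbabilityMeasure P] (hX : IsRetrialQueue lam mu theta P ℱ X)
    (s₀ s : State) : Measurable (jointProb P X s₀ s) :=
  (measurable_measure_prodMk_left
    (hX.measurable_uncurry_real (measurableSet_singleton s))).ennreal_toReal

lemma intervalIntegrable_jointProb [IsProbabilityMeasure P]
    (hX : IsRetrialQueue lam mu theta P ℱ X) (s₀ s : State) (a b : ℝ) :
    IntervalIntegrable (jointProb P X s₀ s) volume a b :=
  (intervalIntegrable_const (c := (1 : ℝ))).mono_fun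
    (hX.measurable_jointProb s₀ s).aestronglyMeasurable (.of_forall fun t => by
      simpa [abs_of_nonneg (jointProb_nonneg s₀ s t)] using jointProb_le_one s₀ s t)

lemma continuous_jointProb [IsProbabilityMeasure P] (hX : IsRetrialQueue lam mu theta P ℱ X)
    (s₀ s : State) : Continuous (jointProb P X s₀ s) := by
  have key : ∀ {n : ℕ} {a : Fin n → ℝ} {r : Fin n → State},
      (∀ s', generator lam mu theta (Pi.single s 1) s'
        = ∑ i, a i * (Pi.single (r i) 1 : State → ℝ) s') →
      Continuous (jointProb P X s₀ s) := by
    intro n a r hgen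
    -- The integral equation holds for `t ≥ 0` and `jointProb` is constant on negative times, hence
    -- `max t 0`.
    have h1 : jointProb P X s₀ s = fun t => jointProb P X s₀ s 0
        + ∫ τ in (0 : ℝ)..(max t 0), ∑ i, a i * jointProb P X s₀ (r i) τ := by
      funext t
      rw [← hX.jointProb_forward s₀ s hgen (le_max_right t 0)]
      simp only [jointProb]
      congr 3
      ext ω
      rw [show (max t 0).toNNReal = t.toNNReal by simp [Real.toNNReal]]
    rw [h1]
    refine continuous_const.add ((intervalIntegral.continuous_primitive (fun a' b' => ?_) 0).comp
      (continuous_id.max continuous_const))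
    have := IntervalIntegrable.sum Finset.univ fun i _ =>
      (hX.intervalIntegrable_jointProb s₀ (r i) a' b').const_mul (a i)
    rwa [show (∑ i, fun τ => a i * jointProb P X s₀ (r i) τ)
      = fun τ => ∑ i, a i * jointProb P X s₀ (r i) τ by ext τ; simp] at this
  obtain ⟨c, k⟩ := s
  fin_cases c
  · exact key (generator_single_busy lam mu theta k)
  · exact key (generator_single_idle lam mu theta k)

lemma hasDerivAt_jointProb [IsProbabilityMeasure P] (hX : IsRetrialQueue lam mu theta P ℱ X)
    (s₀ s : State) {n : ℕ} {a : Fin n → ℝ} {r : Fin n → State}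
    (hgen : ∀ s', generator lam mu theta (Pi.single s 1) s'
      = ∑ i, a i * (Pi.single (r i) 1 : State → ℝ) s') {t : ℝ} (ht : 0 < t) :
    HasDerivAt (jointProb P X s₀ s) (∑ i, a i * jointProb P X s₀ (r i) t) t := by
  have hc : Continuous fun τ => ∑ i, a i * jointProb P X s₀ (r i) τ :=
    continuous_finsetSum _ fun i _ => (hX.continuous_jointProb s₀ (r i)).const_mul (a i)
  have h1 := (intervalIntegral.integral_hasDerivAt_right (hc.intervalIntegrable 0 t)
    hc.aestronglyMeasurable.stronglyMeasurableAtFilter hc.continuousAt).const_add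
      (jointProb P X s₀ s 0)
  refine h1.congr_of_eventuallyEq ?_
  filter_upwards [eventually_gt_nhds ht] with τ hτ
  exact hX.jointProb_forward s₀ s hgen hτ.le

lemma isForwardSolution_jointProb [IsProbabilityMeasure P]
    (hX : IsRetrialQueue lam mu theta P ℱ X) (s₀ : State) :
    IsForwardSolution lam mu theta (P.real {ω | X 0 ω = s₀}) (jointProb P X s₀) where
  nonneg := jointProb_nonneg s₀
  hasSum t := by
    have := hasSum_measureReal_fiber (P.restrict {ω | X 0 ω = s₀}) (hX.measurable t.toNNReal)
    rwa [measureReal_restrict_apply_univ] at this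
  continuous := hX.continuous_jointProb s₀
  hasDerivAt_busy k t ht := by
    refine (hX.hasDerivAt_jointProb s₀ (busy, k) (generator_single_busy lam mu theta k)
      ht).congr_deriv ?_
    simp only [Fin.sum_univ_four]
    by_cases hk : k = 0
    · simp [hk]; ring
    · simp [hk]; ring
  hasDerivAt_idle k t ht := by
    refine (hX.hasDerivAt_jointProb s₀ (idle, k) (generator_single_idle lam mu theta k)
      ht).congr_deriv ?_
    simp only [Fin.sum_univ_two]
    simp; ring

/-- Fixing the starting state bounds the initial mass by `x / x s₀`, the domination that the
comparison requires and that a general initial law may lack. -/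
lemma tendsto_jointProb [IsProbabilityMeasure P] (hX : IsRetrialQueue lam mu theta P ℱ X)
    {x : State → ℝ} (h : IsStationary lam mu theta x) (hlam : 0 < lam) (hmu : 0 < mu)
    (htheta : 0 < theta) (s₀ s : State) :
    Tendsto (jointProb P X s₀ s) atTop (𝓝 (P.real {ω | X 0 ω = s₀} * x s)) := by
  refine (hX.isForwardSolution_jointProb s₀).tendsto_stationary h hlam hmu htheta (c := 1 / x s₀)
    (one_div_nonneg.2 (h.pos _).le) (fun s => ?_) s
  by_cases hs : s = s₀
  · subst hs
    rw [one_div_mul_cancel (h.pos _).ne']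
    exact jointProb_le_one _ _ _
  · have h0 : jointProb P X s₀ s 0 = 0 := by
      rw [jointProb, measureReal_restrict_apply (hX.measurableSet_fiber _ s),
        Real.toNNReal_zero]
      have : {ω | X 0 ω = s} ∩ {ω | X 0 ω = s₀} = ∅ := by
        ext ω
        simp only [Set.mem_inter_iff, Set.mem_ofPred_eq, Set.mem_empty_iff_false, iff_false, not_and]
        exact fun h1 h2 => hs (h1.symm.trans h2)
      rw [this, measureReal_empty]
    rw [h0]
    exact mul_nonneg (one_div_nonneg.2 (h.pos _).le) (h.pos _).le

/-- The chain converges in law to the stationary distribution. -/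
lemma tendsto_prob [IsProbabilityMeasure P] (hX : IsRetrialQueue lam mu theta P ℱ X)
    {x : State → ℝ} (h : IsStationary lam mu theta x) (hlam : 0 < lam) (hmu : 0 < mu)
    (htheta : 0 < theta) (s : State) :
    Tendsto (fun t : ℝ≥0 => P.real {ω | X t ω = s}) atTop (𝓝 (x s)) := by
  have hinit := hasSum_measureReal_fiber P (hX.measurable 0)
  rw [probReal_univ] at hinit
  have h1 : Tendsto (fun t : ℝ => ∑' s₀, jointProb P X s₀ s t) atTop
      (𝓝 (∑' s₀, P.real {ω | X 0 ω = s₀} * x s)) := by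
    refine tendsto_tsum_of_dominated_convergence hinit.summable
      (fun s₀ => hX.tendsto_jointProb h hlam hmu htheta s₀ s) (.of_forall fun t s₀ => ?_)
    rw [Real.norm_of_nonneg (jointProb_nonneg _ _ _), jointProb,
      measureReal_restrict_apply (hX.measurableSet_fiber _ s)]
    exact measureReal_mono Set.inter_subset_right
  rw [(hinit.mul_right (x s)).tsum_eq, one_mul] at h1
  refine (h1.comp (NNReal.tendsto_coe_atTop.2 tendsto_id)).congr fun t => ?_
  simp only [Function.comp, jointProb, id, Real.toNNReal_coe]
  have h2 := hasSum_measureReal_fiber (P.restrict {ω | X t ω = s}) (hX.measurable 0)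
  rw [measureReal_restrict_apply_univ] at h2
  rw [← h2.tsum_eq]
  refine tsum_congr fun s₀ => ?_
  rw [measureReal_restrict_apply (hX.measurableSet_fiber _ s),
    measureReal_restrict_apply (hX.measurableSet_fiber _ s₀), Set.inter_comm]

end IsRetrialQueue

end RetrialQueue

theorem mainTheorem7 {Ω : Type*} {mΩ : MeasurableSpace Ω} (P : Measure Ω) [IsProbabilityMeasure P]
    (ℱ : Filtration ℝ≥0 mΩ) (X : ℝ≥0 → Ω → RetrialQueue.State)
    (lam mu theta rho : ℝ) (hlam : 0 < lam) (hmu : 0 < mu) (htheta : 0 < theta)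
    (hrho : rho = lam / mu) (hstable : rho < 1)
    (hX : RetrialQueue.IsRetrialQueue lam mu theta P ℱ X) :
    ∃ x : RetrialQueue.State → ℝ,
      -- the limiting probabilities exist and form a probability vector
      (∀ s, Tendsto (fun t : ℝ≥0 => P.real {ω | X t ω = s}) atTop (𝓝 (x s))) ∧
      (∀ s, 0 ≤ x s) ∧ HasSum x 1 ∧
      RetrialQueue.tailPair x 0 = ![rho, 1 - rho] ∧
      -- the linear system `Π Q = (-λρ, 0, 0, …)`, block column by block column
      (∀ j : ℕ, HasSum
        (fun i : ℕ => RetrialQueue.tailPair x (i + 1) ᵥ* RetrialQueue.Q lam mu theta i j)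
        (if j = 0 then ![-(lam * rho), 0] else 0)) ∧
      -- the `R`-measure exists
      (∃ R : ℕ → RetrialQueue.Block, RetrialQueue.IsRMeasure lam mu theta R) ∧
      ∀ R : ℕ → RetrialQueue.Block, RetrialQueue.IsRMeasure lam mu theta R →
        (∀ k : ℕ, 1 ≤ k → IsUnit (RetrialQueue.Psi lam mu theta R k)) ∧
        (∀ k : ℕ, 1 ≤ k →
          R k = RetrialQueue.blockC lam * (-RetrialQueue.Psi lam mu theta R (k + 1))⁻¹) ∧
        -- all the series in the definitions of `Ψ_k`, `G_{i,i-1}` and `G_i` converge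
        (∀ k : ℕ, 1 ≤ k → Summable (fun l : ℕ => RetrialQueue.prodR R k (l + 1))) ∧
        -- the factorization `Q = (I - R_U) U_D (I - G_L)`
        RetrialQueue.Q lam mu theta =
          RetrialQueue.blockMul
            (RetrialQueue.blockMul (1 - RetrialQueue.factorRU R) (RetrialQueue.factorUD lam mu theta R))
            (1 - RetrialQueue.factorGL lam mu theta R) ∧
        -- the tail probabilities
        RetrialQueue.tailPair x 1 =
          ![lam * rho, 0] ᵥ* (-(RetrialQueue.Psi lam mu theta R 1)⁻¹) ∧
        ∀ k : ℕ, 2 ≤ k →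
          RetrialQueue.tailPair x k =
            ![lam * rho, 0] ᵥ*
              (-(RetrialQueue.Psi lam mu theta R 1)⁻¹ * RetrialQueue.prodR R 1 (k - 1)) := by
  subst hrho
  obtain ⟨x, h⟩ := RetrialQueue.exists_isStationary hlam hmu htheta hstable
  refine ⟨x, hX.tendsto_prob h hlam hmu htheta, fun s => (h.pos s).le, h.hasSum,
    h.tailPair_zero hmu, h.hasSum_tailPair_vecMul_Q hmu,
    ⟨_, h.isRMeasure_tailRatio hmu htheta⟩, fun R hRM => ?_⟩
  -- Uniqueness replaces an arbitrary `R`-measure by the explicit one at all indices `k ≥ 1`.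
  have hR : ∀ k, 1 ≤ k → R k = RetrialQueue.tailRatio x k := fun k hk =>
    h.eq_tailRatio_of_isNonnegSolution hmu htheta hRM.1 hk
  have hunit := fun k (hk : 1 ≤ k) => h.isUnit_Psi hlam htheta hR hk
  have hsum := fun k (hk : 1 ≤ k) => (h.hasSum_prodR hR hk).summable
  refine ⟨hunit, fun k hk => h.eq_mul_neg_Psi_inv hlam htheta hR hk, hsum,
    RetrialQueue.Q_eq_blockMul hunit (fun k hk => h.blockC_add_mul_Psi hR hk) hsum,
    h.tailPair_one_eq hlam hmu htheta hR, fun k hk => ?_⟩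
  obtain ⟨l, rfl⟩ := Nat.exists_eq_add_of_le' hk
  rw [h.tailPair_one_vecMul_prodR hR l, h.tailPair_one_eq hlam hmu htheta hR,
    Matrix.vecMul_vecMul, show l + 2 - 1 = l + 1 by omega]
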